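/- Let $d,d'\ge 1$ be integers, $D=d+d'$, $0<p<\infty$, $0<q\le\infty$, $s-D/p>0$, $\alpha\ge 1$, and $$H(\alpha)=s-\frac dp+\frac{d}{\alpha p}.$$ Wavelets. Let $N\ge\lfloor s+1\rfloor$ and let $\Psi^0,\Psi^1\in C^N(\mathbb R)$ be the real, compactly supported scaling function and mother wavelet of an orthonormal multiresolution analysis of $L^2(\mathbb R)$: the functions $\Psi^0(\cdot-k)$ and $\Psi^1(\cdot-k)$, $k\in\mathbb Z$, together form an orthonormal family, $\Psi^0$ and $\Psi^1$ are finite linear combinations of the $\Psi^0(2\,\cdot-k)$, and the functions $\Psi^1(2^j\cdot-k)$, $j,k\in\mathbb Z$, form an orthogonal basis of $L^2(\mathbb R)$. Assume that $\int x^n\Psi^1(x)\,dx=0$ for $0\le n\le N$, and that the $1$-periodic function $G(t)=\sum_{k\in\mathbb Z}\Psi^1(t-k)$ has only finitely many zeros in $[0,1]$, with $G'\ne0$ at each of them. Besov space. For $j\ge1$, $k\in\{0,\dots,2^j-1\}^D$ and $l\in\{0,1\}^D\setminus\{0\}$ put $\Psi_{j,k,l}(x)=\prod_{i=1}^D\Psi^{l_i}(2^jx_i-k_i)$.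 The space $B^s_{p,q}([0,1]^D)$ consists of the functions $f=\sum_{j,k,l}c_{j,k,l}\Psi_{j,k,l}$ on $\mathbb R^D$ with real coefficients for which the (quasi-)norm $$\|f\|=\Big(\sum_{j\ge1}\Big(2^{(sp-D)j}\sum_{k,l}|c_{j,k,l}|^p\Big)^{q/p}\Big)^{1/q}$$ (a supremum over $j$ if $q=\infty$) is finite; here $c_{j,k,l}=2^{jD}\int f\,\Psi_{j,k,l}$. It carries the topology of this (quasi-)norm. As $s>D/p$, its elements are continuous functions, and for $a\in[0,1]^{d'}$ the trace of $f$ is $f_a(x)=f(x,a)$, $x\in\mathbb R^d$. Pointwise regularity. For $g:\mathbb R^d\to\mathbb R$ and $\gamma\ge0$, $g\in C^\gamma(x_0)$ means that there are a polynomial $P$ of degree at most $\lfloor\gamma\rfloor$ and $C>0$ with $|g(x)-P(x-x_0)|\le C|x-x_0|^\gamma$ for $x$ near $x_0$, and $h_g(x_0)=\sup\{\gamma\ge0: g\in C^\gamma(x_0)\}\in[0,\infty]$. Dyadic approximation. $\mathcal X^\alpha$ is the set of $x\in[0,1]^d$ such that for infinitely many $j$ there is $k\in\{0,\dots,2^j-1\}^d$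 with $|x-k2^{-j}|_\infty\le 2^{-j\alpha}$. Prevalence. A subset of a topological vector space $E$ is shy if it is included in a universally measurable set $B$ for which there is a Borel measure $\mu$ on $E$, positive and finite on some compact set, with $\mu(B+x)=0$ for all $x\in E$; a set is prevalent if its complement is shy. (Universally measurable: measurable for the completion of every finite Borel measure.) Theorem. The set $$\mathcal F_\alpha=\Big\{f\in B^s_{p,q}([0,1]^D):\ \text{for Lebesgue-almost every } a\in[0,1]^{d'},\ \forall x\in\mathcal X^\alpha,\ h_{f_a}(x)\le H(\alpha)\Big\}$$ is prevalent in $B^s_{p,q}([0,1]^D)$. -/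

import Mathlib

open MeasureTheory Filter Topology
open scoped ENNReal

noncomputable section

/-! ### Prevalence -/

section Prevalence

variable {E : Type*} [AddCommGroup E] [TopologicalSpace E] [MeasurableSpace E] [BorelSpace E]

/-- A set is universally measurable if it belongs to the completion of the Borel `σ`-algebra
with respect to every finite (equivalently, every `σ`-finite) Borel measure. -/
def UniversallyMeasurable (A : Set E) : Prop :=
  ∀ μ : Measure E, IsFiniteMeasure μ → NullMeasurableSet A μ

/-- A set is shy if it is included in a universally measurable set `B` such that some Borel
measure, positive and finite on some compact set, vanishes on all the translates of `B`. -/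
def IsShy (A : Set E) : Prop :=
  ∃ B : Set E, A ⊆ B ∧ UniversallyMeasurable B ∧
    ∃ μ : Measure E, (∃ K : Set E, IsCompact K ∧ 0 < μ K ∧ μ K < ⊤) ∧
      ∀ x : E, μ ((fun y => y + x) '' B) = 0

/-- A set is prevalent if its complement is shy. -/
def IsPrevalent (A : Set E) : Prop := IsShy Aᶜ

end Prevalence

/-! ### Wavelets -/

/-- `φ` and `ψ` are the compactly supported scaling function and mother wavelet of an
`N`-regular orthonormal multiresolution analysis of `L²(ℝ)`. -/
structure IsRegularWaveletPair (N : ℕ) (φ ψ : ℝ → ℝ) : Prop where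
  contDiff_scaling : ContDiff ℝ N φ
  contDiff_wavelet : ContDiff ℝ N ψ
  hasCompactSupport_scaling : HasCompactSupport φ
  hasCompactSupport_wavelet : HasCompactSupport ψ
  vanishing_moments : ∀ n : ℕ, n ≤ N → ∫ x : ℝ, x ^ n * ψ x = 0
  orthonormal_scaling : ∀ k m : ℤ, ∫ x : ℝ, φ (x - k) * φ (x - m) = if k = m then 1 else 0
  orthonormal_wavelet : ∀ k m : ℤ, ∫ x : ℝ, ψ (x - k) * ψ (x - m) = if k = m then 1 else 0
  orthogonal : ∀ k m : ℤ, ∫ x : ℝ, φ (x - k) * ψ (x - m) = 0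
  /-- The space spanned by the `φ (· - k)` is included in the one spanned by the
  `φ (2 · - k)`. -/
  refinement : ∃ h : ℤ →₀ ℝ, ∀ x : ℝ, φ x = h.sum fun k r => r * φ (2 * x - k)
  /-- The wavelet belongs to the space spanned by the `φ (2 · - k)`. -/
  wavelet_mem : ∃ g : ℤ →₀ ℝ, ∀ x : ℝ, ψ x = g.sum fun k r => r * φ (2 * x - k)
  /-- The functions `x ↦ ψ (2 ^ j x - k)`, `j, k ∈ ℤ`, are total in `L²(ℝ)`; they are pairwise
  orthogonal by the preceding fields. -/
  total : (Submodule.span ℝ {F : Lp ℝ 2 (volume : Measure ℝ) |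
    ∃ j k : ℤ, F =ᵐ[volume] fun x : ℝ => ψ ((2 : ℝ) ^ j * x - k)}).topologicalClosure = ⊤

/-- The periodized wavelet `G(t) = ∑_{k ∈ ℤ} ψ(t - k)`. -/
def periodizedWavelet (ψ : ℝ → ℝ) (t : ℝ) : ℝ := ∑' k : ℤ, ψ (t - k)

/-- The hypothesis `(𝓗_N)`: the wavelet is `N`-regular, and the periodized wavelet has finitely
many zeros in `[0,1]`, all of them simple. -/
structure WaveletHypothesis (N : ℕ) (φ ψ : ℝ → ℝ) : Prop where
  regular : IsRegularWaveletPair N φ ψ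
  finite_zeros : {t : ℝ | t ∈ Set.Icc (0 : ℝ) 1 ∧ periodizedWavelet ψ t = 0}.Finite
  simple_zeros : ∀ t ∈ Set.Icc (0 : ℝ) 1, periodizedWavelet ψ t = 0 →
    0 < |deriv (periodizedWavelet ψ) t|

/-- The positions and types at scale `j`: pairs `(k, l)` with `k ∈ {0, …, 2^j - 1}^D` and
`l ∈ {0,1}^D \ {0}`. -/
abbrev ScaleIndex (D : ℕ) (j : ℕ+) : Type :=
  (Fin D → Fin (2 ^ (j : ℕ))) × {l : Fin D → Bool // l ≠ fun _ => false}

/-- The indices `(j, k, l)` of the wavelets localized on `[0,1]^D`, with `j ≥ 1`. -/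
abbrev WaveletIndex (D : ℕ) : Type := Σ j : ℕ+, ScaleIndex D j

/-- The tensorized wavelet `Ψ_{j,k,l}(x) = ∏ᵢ Ψ^{lᵢ}(2^j xᵢ - kᵢ)`, where `Ψ⁰ = φ` is the
scaling function and `Ψ¹ = ψ` the mother wavelet (`L^∞` normalization). -/
def tensorWavelet {D : ℕ} (φ ψ : ℝ → ℝ) (lam : WaveletIndex D) (x : Fin D → ℝ) : ℝ :=
  ∏ i : Fin D, (if lam.2.2.1 i then ψ else φ)
    ((2 : ℝ) ^ (lam.1 : ℕ) * x i - ((lam.2.1 i : ℕ) : ℝ))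

/-- The wavelet coefficient `c_λ = 2^{jD} ∫ f Ψ_λ`. -/
def waveletCoeff {D : ℕ} (φ ψ : ℝ → ℝ) (f : (Fin D → ℝ) → ℝ) (lam : WaveletIndex D) : ℝ :=
  (2 : ℝ) ^ ((lam.1 : ℕ) * D) * ∫ x : Fin D → ℝ, f x * tensorWavelet φ ψ lam x

/-! ### Besov spaces -/

section Besov

variable {D : ℕ}

/-- `2^{(sp - D) j} ∑_{k, l} |c_{j,k,l}|^p`. -/
def besovLevel (s p : ℝ) (c : WaveletIndex D → ℝ) (j : ℕ+) : ℝ≥0∞ :=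
  (2 : ℝ≥0∞) ^ ((s * p - D) * ((j : ℕ) : ℝ)) * ∑ kl : ScaleIndex D j, ‖c ⟨j, kl⟩‖ₑ ^ p

/-- The Besov (quasi-)norm of a family of wavelet coefficients. -/
def besovSeqNorm (s p : ℝ) (q : ℝ≥0∞) (c : WaveletIndex D → ℝ) : ℝ≥0∞ :=
  if q = ⊤ then ⨆ j, besovLevel s p c j ^ (1 / p)
  else (∑' j, besovLevel s p c j ^ (q.toReal / p)) ^ (1 / q.toReal)

theorem ennreal_add_rpow_le (x y : ℝ≥0∞) {r : ℝ} (hr : 0 ≤ r) :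
    (x + y) ^ r ≤ 2 ^ r * (x ^ r + y ^ r) := by
  have h1 : x + y ≤ 2 * max x y := by
    rw [two_mul]; exact add_le_add (le_max_left _ _) (le_max_right _ _)
  calc (x + y) ^ r ≤ (2 * max x y) ^ r := ENNReal.rpow_le_rpow h1 hr
    _ = 2 ^ r * (max x y) ^ r := ENNReal.mul_rpow_of_nonneg _ _ hr
    _ ≤ 2 ^ r * (x ^ r + y ^ r) := by
      gcongr
      rcases max_choice x y with h | h <;> rw [h]
      · exact le_self_add
      · exact le_add_self

theorem besovLevel_add_le (s : ℝ) {p : ℝ} (hp : 0 < p) (c c' : WaveletIndex D → ℝ) (j : ℕ+) :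
    besovLevel s p (c + c') j ≤ 2 ^ p * (besovLevel s p c j + besovLevel s p c' j) := by
  unfold besovLevel
  rw [← mul_add, ← Finset.sum_add_distrib, mul_left_comm (2 ^ p),
    Finset.mul_sum _ _ (2 ^ p)]
  refine mul_le_mul_right (Finset.sum_le_sum fun kl _ => ?_) _
  exact (ENNReal.rpow_le_rpow (enorm_add_le _ _) hp.le).trans (ennreal_add_rpow_le _ _ hp.le)

theorem besovLevel_add_rpow_le (s : ℝ) {p : ℝ} (hp : 0 < p) (c c' : WaveletIndex D → ℝ)
    (j : ℕ+) {r : ℝ} (hr : 0 ≤ r) :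
    besovLevel s p (c + c') j ^ r ≤
      (2 ^ p) ^ r * 2 ^ r * (besovLevel s p c j ^ r + besovLevel s p c' j ^ r) := by
  refine (ENNReal.rpow_le_rpow (besovLevel_add_le s hp c c' j) hr).trans ?_
  rw [ENNReal.mul_rpow_of_nonneg _ _ hr, mul_assoc]
  gcongr
  exact ennreal_add_rpow_le _ _ hr

theorem besovLevel_smul (s : ℝ) {p : ℝ} (hp : 0 < p) (t : ℝ) (c : WaveletIndex D → ℝ) (j : ℕ+) :
    besovLevel s p (t • c) j = ‖t‖ₑ ^ p * besovLevel s p c j := by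
  unfold besovLevel
  rw [mul_left_comm (‖t‖ₑ ^ p), Finset.mul_sum _ _ (‖t‖ₑ ^ p)]
  refine congrArg _ (Finset.sum_congr rfl fun kl _ => ?_)
  rw [Pi.smul_apply, smul_eq_mul, enorm_mul, ENNReal.mul_rpow_of_nonneg _ _ hp.le]

theorem besovSeqNorm_lt_top_iff (s p : ℝ) {q : ℝ≥0∞} (hq : 0 < q) (hq' : q ≠ ⊤)
    (c : WaveletIndex D → ℝ) :
    besovSeqNorm s p q c < ⊤ ↔ ∑' j, besovLevel s p c j ^ (q.toReal / p) < ⊤ := by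
  have hqr : 0 < q.toReal := ENNReal.toReal_pos hq.ne' hq'
  rw [besovSeqNorm, if_neg hq', ENNReal.rpow_lt_top_iff_of_pos (by positivity)]

theorem two_rpow_ne_top (r : ℝ) : (2 : ℝ≥0∞) ^ r ≠ ⊤ :=
  ENNReal.rpow_ne_top_of_ne_zero two_ne_zero ENNReal.ofNat_ne_top

theorem besovSeqNorm_zero_lt_top (s : ℝ) {p : ℝ} (hp : 0 < p) {q : ℝ≥0∞} (hq : 0 < q) :
    besovSeqNorm s p q (0 : WaveletIndex D → ℝ) < ⊤ := by
  have h0 : ∀ j, besovLevel s p (0 : WaveletIndex D → ℝ) j = 0 := fun j => by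
    simp [besovLevel, hp]
  by_cases hq' : q = ⊤
  · simp [besovSeqNorm, hq', h0, hp]
  · have hqr : 0 < q.toReal := ENNReal.toReal_pos hq.ne' hq'
    rw [besovSeqNorm_lt_top_iff s p hq hq']
    simp [h0, div_pos hqr hp]

theorem besovSeqNorm_add_lt_top (s : ℝ) {p : ℝ} (hp : 0 < p) {q : ℝ≥0∞} (hq : 0 < q)
    {c c' : WaveletIndex D → ℝ} (hc : besovSeqNorm s p q c < ⊤)
    (hc' : besovSeqNorm s p q c' < ⊤) : besovSeqNorm s p q (c + c') < ⊤ := by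
  have hK : ∀ r : ℝ, 0 ≤ r → ((2 : ℝ≥0∞) ^ p) ^ r * 2 ^ r < ⊤ := fun r hr =>
    ENNReal.mul_lt_top (ENNReal.rpow_lt_top_of_nonneg hr (two_rpow_ne_top p))
      (two_rpow_ne_top r).lt_top
  by_cases hq' : q = ⊤
  · simp only [besovSeqNorm, if_pos hq'] at hc hc' ⊢
    have hr : 0 ≤ 1 / p := by positivity
    refine lt_of_le_of_lt (iSup_le fun j => ?_)
      (ENNReal.mul_lt_top (hK _ hr) (ENNReal.add_lt_top.2 ⟨hc, hc'⟩))
    refine (besovLevel_add_rpow_le s hp c c' j hr).trans ?_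
    gcongr
    · exact le_iSup (fun j => besovLevel s p c j ^ (1 / p)) j
    · exact le_iSup (fun j => besovLevel s p c' j ^ (1 / p)) j
  · rw [besovSeqNorm_lt_top_iff s p hq hq'] at hc hc' ⊢
    have hr : 0 ≤ q.toReal / p := by positivity
    refine lt_of_le_of_lt
      (ENNReal.tsum_le_tsum fun j => besovLevel_add_rpow_le s hp c c' j hr) ?_
    rw [ENNReal.tsum_mul_left, ENNReal.tsum_add]
    exact ENNReal.mul_lt_top (hK _ hr) (ENNReal.add_lt_top.2 ⟨hc, hc'⟩)

theorem besovSeqNorm_smul_lt_top (s : ℝ) {p : ℝ} (hp : 0 < p) {q : ℝ≥0∞} (hq : 0 < q)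
    (t : ℝ) {c : WaveletIndex D → ℝ} (hc : besovSeqNorm s p q c < ⊤) :
    besovSeqNorm s p q (t • c) < ⊤ := by
  have hK : ∀ r : ℝ, 0 ≤ r → (‖t‖ₑ ^ p) ^ r < ⊤ := fun r hr =>
    ENNReal.rpow_lt_top_of_nonneg hr (ENNReal.rpow_lt_top_of_nonneg hp.le enorm_ne_top).ne
  by_cases hq' : q = ⊤
  · simp only [besovSeqNorm, if_pos hq'] at hc ⊢
    have hr : 0 ≤ 1 / p := by positivity
    simp only [besovLevel_smul s hp, ENNReal.mul_rpow_of_nonneg _ _ hr, ← ENNReal.mul_iSup]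
    exact ENNReal.mul_lt_top (hK _ hr) hc
  · rw [besovSeqNorm_lt_top_iff s p hq hq'] at hc ⊢
    have hr : 0 ≤ q.toReal / p := by positivity
    simp only [besovLevel_smul s hp, ENNReal.mul_rpow_of_nonneg _ _ hr, ENNReal.tsum_mul_left]
    exact ENNReal.mul_lt_top (hK _ hr) hc

/-- The vector space of the functions `f = ∑_λ c_λ Ψ_λ` on `ℝ^D`, the sum being over the
wavelets localized on `[0,1]^D`, with coefficients of finite Besov (quasi-)norm. -/
def besovSubmodule (D : ℕ) (φ ψ : ℝ → ℝ) (s : ℝ) {p : ℝ} (hp : 0 < p) {q : ℝ≥0∞} (hq : 0 < q) :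
    Submodule ℝ ((Fin D → ℝ) → ℝ) where
  carrier := {f | ∃ c : WaveletIndex D → ℝ, besovSeqNorm s p q c < ⊤ ∧
    ∀ x, HasSum (fun lam => c lam * tensorWavelet φ ψ lam x) (f x)}
  zero_mem' := ⟨0, besovSeqNorm_zero_lt_top s hp hq, fun x => by simp [hasSum_zero]⟩
  add_mem' := by
    rintro f g ⟨c, hc, hf⟩ ⟨c', hc', hg⟩
    refine ⟨c + c', besovSeqNorm_add_lt_top s hp hq hc hc', fun x => ?_⟩
    simpa only [Pi.add_apply, add_mul] using (hf x).add (hg x)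
  smul_mem' := by
    rintro t f ⟨c, hc, hf⟩
    refine ⟨t • c, besovSeqNorm_smul_lt_top s hp hq t hc, fun x => ?_⟩
    simpa only [Pi.smul_apply, smul_eq_mul, mul_assoc] using (hf x).mul_left t

/-- The Besov space `B^s_{p,q}([0,1]^D)`. -/
def BesovSpace (D : ℕ) (φ ψ : ℝ → ℝ) (s : ℝ) {p : ℝ} (hp : 0 < p) {q : ℝ≥0∞} (hq : 0 < q) :
    Type :=
  ↥(besovSubmodule D φ ψ s hp hq)

variable {φ ψ : ℝ → ℝ} {s p : ℝ} {hp : 0 < p} {q : ℝ≥0∞} {hq : 0 < q}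

instance : AddCommGroup (BesovSpace D φ ψ s hp hq) :=
  inferInstanceAs (AddCommGroup ↥(besovSubmodule D φ ψ s hp hq))

instance : Module ℝ (BesovSpace D φ ψ s hp hq) :=
  inferInstanceAs (Module ℝ ↥(besovSubmodule D φ ψ s hp hq))

/-- An element of the Besov space, seen as a function on `ℝ^D`. -/
def BesovSpace.toFun (f : BesovSpace D φ ψ s hp hq) : (Fin D → ℝ) → ℝ := f.1

/-- The Besov (quasi-)norm of a function, computed from its wavelet coefficients. -/
def BesovSpace.quasiNorm (f : BesovSpace D φ ψ s hp hq) : ℝ≥0∞ :=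
  besovSeqNorm s p q (waveletCoeff φ ψ f.toFun)

/-- The topology of the Besov (quasi-)norm. -/
instance : TopologicalSpace (BesovSpace D φ ψ s hp hq) where
  IsOpen U := ∀ f ∈ U, ∃ ε : ℝ≥0∞, 0 < ε ∧
    ∀ g : BesovSpace D φ ψ s hp hq, (g - f).quasiNorm < ε → g ∈ U
  isOpen_univ := fun _ _ => ⟨1, one_pos, fun _ _ => Set.mem_univ _⟩
  isOpen_inter := by
    intro U V hU hV f hf
    obtain ⟨ε, hε, h⟩ := hU f hf.1
    obtain ⟨δ, hδ, h'⟩ := hV f hf.2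
    exact ⟨min ε δ, lt_min hε hδ, fun g hg =>
      ⟨h g (hg.trans_le (min_le_left _ _)), h' g (hg.trans_le (min_le_right _ _))⟩⟩
  isOpen_sUnion := by
    intro S hS f hf
    obtain ⟨U, hU, hfU⟩ := hf
    obtain ⟨ε, hε, h⟩ := hS U hU f hfU
    exact ⟨ε, hε, fun g hg => ⟨U, hU, h g hg⟩⟩

instance : MeasurableSpace (BesovSpace D φ ψ s hp hq) := borel _

instance : BorelSpace (BesovSpace D φ ψ s hp hq) := ⟨rfl⟩

end Besov

/-! ### Pointwise regularity, traces and dyadic approximation -/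

/-- `f ∈ C^γ(x₀)`: near `x₀`, `f` is within `C |x - x₀|^γ` of a polynomial in `x - x₀` of degree
at most `⌊γ⌋`. -/
def IsPointwiseHolder {d : ℕ} (f : (Fin d → ℝ) → ℝ) (γ : ℝ) (x₀ : Fin d → ℝ) : Prop :=
  ∃ (P : MvPolynomial (Fin d) ℝ) (C : ℝ), P.totalDegree ≤ ⌊γ⌋₊ ∧ 0 < C ∧
    ∀ᶠ x in 𝓝 x₀, |f x - MvPolynomial.eval (x - x₀) P| ≤ C * ‖x - x₀‖ ^ γ

/-- The pointwise Hölder exponent `h_f(x₀) = sup {γ ≥ 0 : f ∈ C^γ(x₀)}`, possibly `+∞`. -/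
def holderExponent {d : ℕ} (f : (Fin d → ℝ) → ℝ) (x₀ : Fin d → ℝ) : EReal :=
  sSup {h : EReal | ∃ γ : ℝ, 0 ≤ γ ∧ IsPointwiseHolder f γ x₀ ∧ h = (γ : EReal)}

/-- The trace `f_a(x) = f(x, a)`. -/
def traceAt {d d' : ℕ} (f : (Fin (d + d') → ℝ) → ℝ) (a : Fin d' → ℝ) : (Fin d → ℝ) → ℝ :=
  fun x => f (Fin.append x a)

/-- The points `x ∈ [0,1]^d` which, for infinitely many `j`, are at `ℓ^∞` distance at most
`2^{-jα}` from some `k 2^{-j}` with `k ∈ {0, …, 2^j - 1}^d`. -/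
def dyadicApprox (d : ℕ) (α : ℝ) : Set (Fin d → ℝ) :=
  {x | x ∈ Set.Icc (0 : Fin d → ℝ) 1 ∧ ∃ᶠ j : ℕ in atTop, ∃ k : Fin d → Fin (2 ^ j),
    ∀ i, |x i - ((k i : ℕ) : ℝ) / (2 : ℝ) ^ j| ≤ (2 : ℝ) ^ (-((j : ℝ) * α))}

/-- `H(α) = s - d/p + d/(αp)`. -/
def exponentH (d : ℕ) (s p α : ℝ) : ℝ := s - d / p + d / (α * p)

end

/-! Suppose that `h_{f_a}(x) > H(α)` at some `x ∈ 𝒳^α`. Then `f_a` is `C^γ` at `x` for some `H(α) <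
γ ≤ N`, and for infinitely many `J` some dyadic point `K 2^{-J}` lies within `ρ = 2^{-αJ}` of `x`.
By the vanishing moments, every coefficient of `f_a` against a tensor product of mother wavelets
located at `K 2^{-J}`, at any scale `j ≥ αJ`, is `O(ρ^γ)` with the same `ρ`
(`exists_decay_of_isPointwiseHolder`). It therefore suffices that the event `HasSmallCoeffs` happens
for only finitely many `J`, for every `n` and almost every `a`.

The measure witnessing shyness is the law of a random probe `∑_j z_j ∑_k e_{j,k} Ψ_{j,k,(1,…,1)}`,
with `z_j` independent and uniform in `[0,1]`. Up to powers of `j`, `e_{j,k}` is at least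
`2^{-(s-d/p)j} 2^{-dJ/p}` when the first `d` coordinates of `k 2^{-j}` form a dyadic point of
generation `J`. For `j` close to `αJ` this is `2^{-H(α)αJ}`, while the weights are just summable
enough for the probe to lie in the Besov space (`sum_dyadicWeight_le`).

The coefficient of the trace of the probe is `z_j e_{j,k}` times a factor depending on `a`
(`traceCoeff_probe`), which is eventually `∏ G(2^j a_i)`. As the zeros of `G` are simple, `{t :
|G(2^j t)| < δ}` has measure `O(δ)` uniformly in `j`, so by Borel–Cantelli this factor loses only a
power of `j` for almost every `a` (`ae_eventually_le_abs_prod_sum`).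

Whatever the fixed `f`, a coefficient `u + z_j v` of the perturbed trace is small with probability
at most `2r/|v|`, which is exponentially small in `J`. Independence over `M` successive scales beats
the number `2^{dJ}` of dyadic points once `M` is large, and Borel–Cantelli in `J` concludes for
almost every fixed `a` (`ae_not_frequently_hasSmallCoeffs`). Fubini exchanges "almost every `a`" and
"almost every `z`". -/

/-! ### One-dimensional wavelets -/

/-- The generating function of type `b`: the wavelet `ψ` if `b` holds, else the scaling
function `φ`. -/
def generator (φ ψ : ℝ → ℝ) (b : Bool) : ℝ → ℝ := if b then ψ else φ

theorem tensorWavelet_eq_prod {D : ℕ} (φ ψ : ℝ → ℝ) (lam : WaveletIndex D) (x : Fin D → ℝ) :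
    tensorWavelet φ ψ lam x = ∏ i, generator φ ψ (lam.2.2.1 i)
      ((2 : ℝ) ^ (lam.1 : ℕ) * x i - ((lam.2.1 i : ℕ) : ℝ)) := rfl

theorem integral_comp_dyadic (F : ℝ → ℝ) (j : ℕ) (k : ℝ) :
    ∫ x : ℝ, F ((2 : ℝ) ^ j * x - k) = ((2 : ℝ) ^ j)⁻¹ * ∫ x : ℝ, F x := by
  rw [Measure.integral_comp_mul_left (fun x => F (x - k)), integral_sub_right_eq_self F k,
    abs_of_pos (by positivity), smul_eq_mul]

theorem hasCompactSupport_comp_dyadic {F : ℝ → ℝ} (hF : HasCompactSupport F) (j : ℕ) (k : ℝ) :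
    HasCompactSupport fun x : ℝ => F ((2 : ℝ) ^ j * x - k) := by
  have h2 : ((2 : ℝ) ^ j) ≠ 0 := by positivity
  have := hF.comp_homeomorph ((Homeomorph.mulLeft₀ _ h2).trans (Homeomorph.subRight k))
  exact this

namespace IsRegularWaveletPair

variable {N : ℕ} {φ ψ : ℝ → ℝ}

theorem continuous_generator (h : IsRegularWaveletPair N φ ψ) (b : Bool) :
    Continuous (generator φ ψ b) := by
  cases b
  · exact h.contDiff_scaling.continuous
  · exact h.contDiff_wavelet.continuous

theorem hasCompactSupport_generator (h : IsRegularWaveletPair N φ ψ) (b : Bool) :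
    HasCompactSupport (generator φ ψ b) := by
  cases b
  · exact h.hasCompactSupport_scaling
  · exact h.hasCompactSupport_wavelet

theorem continuous_generator_dyadic (h : IsRegularWaveletPair N φ ψ) (b : Bool) (j : ℕ) (k : ℝ) :
    Continuous fun x : ℝ => generator φ ψ b ((2 : ℝ) ^ j * x - k) :=
  (h.continuous_generator b).comp (by fun_prop)

theorem exists_bound (h : IsRegularWaveletPair N φ ψ) : ∃ R C : ℝ, 0 < R ∧ 0 < C ∧
    (∀ b t, R < |t| → generator φ ψ b t = 0) ∧ ∀ b t, |generator φ ψ b t| ≤ C := by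
  have key : ∀ b, ∃ R C : ℝ, (∀ t, R < |t| → generator φ ψ b t = 0) ∧
      ∀ t, |generator φ ψ b t| ≤ C := fun b => by
    obtain ⟨R, hR⟩ := (h.hasCompactSupport_generator b).isCompact.isBounded.subset_closedBall 0
    obtain ⟨C, hC⟩ := (h.continuous_generator b).bounded_above_of_compact_support
      (h.hasCompactSupport_generator b)
    refine ⟨R, C, fun t ht => ?_, hC⟩
    refine image_eq_zero_of_notMem_tsupport fun hmem => ?_
    have := hR hmem
    rw [mem_closedBall_zero_iff, Real.norm_eq_abs] at this
    linarith
  obtain ⟨R₀, C₀, h₀, h₀'⟩ := key false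
  obtain ⟨R₁, C₁, h₁, h₁'⟩ := key true
  refine ⟨max 1 (max R₀ R₁), max 1 (max C₀ C₁), by positivity, by positivity, ?_, ?_⟩
  · rintro (_ | _) t ht
    · exact h₀ t (lt_of_le_of_lt ((le_max_left _ _).trans (le_max_right _ _)) ht)
    · exact h₁ t (lt_of_le_of_lt ((le_max_right _ _).trans (le_max_right _ _)) ht)
  · rintro (_ | _) t
    · exact (h₀' t).trans ((le_max_left _ _).trans (le_max_right _ _))
    · exact (h₁' t).trans ((le_max_right _ _).trans (le_max_right _ _))

/-- The functions `φ (2^n · - m)`, `m ∈ ℤ`, span a space which increases with `n`. -/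
theorem generator_comp_mem_span (h : IsRegularWaveletPair N φ ψ) (b : Bool) (n : ℕ) (k : ℤ) :
    (fun x : ℝ => generator φ ψ b ((2 : ℝ) ^ n * x - k)) ∈
      Submodule.span ℝ (Set.range fun m : ℤ => fun x : ℝ => φ ((2 : ℝ) ^ (n + 1) * x - m)) := by
  have key : ∃ g : ℤ →₀ ℝ, ∀ x : ℝ, generator φ ψ b x = g.sum fun k r => r * φ (2 * x - k) := by
    cases b
    · exact h.refinement
    · exact h.wavelet_mem
  obtain ⟨g, hg⟩ := key
  have : (fun x : ℝ => generator φ ψ b ((2 : ℝ) ^ n * x - k)) =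
      ∑ m ∈ g.support, g m • (fun x : ℝ => φ ((2 : ℝ) ^ (n + 1) * x - ((2 * k + m : ℤ) : ℝ))) := by
    funext x
    rw [hg, Finsupp.sum, Finset.sum_apply]
    refine Finset.sum_congr rfl fun m _ => ?_
    rw [Pi.smul_apply, smul_eq_mul]
    congr 2
    push_cast
    ring
  rw [this]
  exact Submodule.sum_mem _ fun m _ => Submodule.smul_mem _ _ (Submodule.subset_span ⟨_, rfl⟩)

theorem generator_comp_mem_span_of_lt (h : IsRegularWaveletPair N φ ψ) (b : Bool) {n n' : ℕ}
    (hn : n < n') (k : ℤ) :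
    (fun x : ℝ => generator φ ψ b ((2 : ℝ) ^ n * x - k)) ∈
      Submodule.span ℝ (Set.range fun m : ℤ => fun x : ℝ => φ ((2 : ℝ) ^ n' * x - m)) := by
  induction n', hn using Nat.le_induction with
  | base => exact h.generator_comp_mem_span b n k
  | succ n' _ ih =>
    refine Submodule.span_le.2 ?_ ih
    rintro _ ⟨m, rfl⟩
    exact h.generator_comp_mem_span false n' m

theorem integrable_generator_mul (h : IsRegularWaveletPair N φ ψ) (b : Bool) (j : ℕ) (k : ℝ)
    {F : ℝ → ℝ} (hF : Continuous F) :
    Integrable fun x : ℝ => F x * generator φ ψ b ((2 : ℝ) ^ j * x - k) :=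
  (hF.mul (h.continuous_generator_dyadic b j k)).integrable_of_hasCompactSupport
    (hasCompactSupport_comp_dyadic (h.hasCompactSupport_generator b) j k).mul_left

/-- A wavelet is orthogonal to the generating functions at coarser scales. -/
theorem integral_generator_mul_wavelet_of_lt (h : IsRegularWaveletPair N φ ψ) (b : Bool)
    {n n' : ℕ} (hn : n < n') (k k' : ℤ) :
    ∫ x : ℝ, generator φ ψ b ((2 : ℝ) ^ n * x - k) * ψ ((2 : ℝ) ^ n' * x - k') = 0 := by
  have key : ∀ F ∈ Submodule.span ℝ
      (Set.range fun m : ℤ => fun x : ℝ => φ ((2 : ℝ) ^ n' * x - m)),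
      Integrable (fun x => F x * ψ ((2 : ℝ) ^ n' * x - k')) ∧
        ∫ x, F x * ψ ((2 : ℝ) ^ n' * x - k') = 0 := by
    intro F hF
    induction hF using Submodule.span_induction with
    | mem F hF =>
      obtain ⟨m, rfl⟩ := hF
      refine ⟨h.integrable_generator_mul true n' k' (h.continuous_generator_dyadic false n' m), ?_⟩
      have := integral_comp_dyadic (fun x => φ (x - m) * ψ (x - k')) n' 0
      simp only [sub_zero] at this
      simp only
      rw [this, h.orthogonal, mul_zero]
    | zero => simp
    | add F G _ _ hF hG =>
      simp only [Pi.add_apply, add_mul]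
      refine ⟨hF.1.add hG.1, ?_⟩
      rw [integral_add hF.1 hG.1, hF.2, hG.2, add_zero]
    | smul r F _ hF =>
      simp only [Pi.smul_apply, smul_eq_mul, mul_assoc]
      refine ⟨hF.1.const_mul r, ?_⟩
      rw [integral_const_mul, hF.2, mul_zero]
  exact (key _ (h.generator_comp_mem_span_of_lt b hn k)).2

theorem integral_generator_mul_generator (h : IsRegularWaveletPair N φ ψ) (b b' : Bool) (n : ℕ)
    (k k' : ℤ) :
    ∫ x : ℝ, generator φ ψ b ((2 : ℝ) ^ n * x - k) * generator φ ψ b' ((2 : ℝ) ^ n * x - k') =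
      if b = b' ∧ k = k' then ((2 : ℝ) ^ n)⁻¹ else 0 := by
  have := integral_comp_dyadic (fun x => generator φ ψ b (x - k) * generator φ ψ b' (x - k')) n 0
  simp only [sub_zero] at this
  rw [this]
  cases b <;> cases b'
  · simp only [generator, Bool.false_eq_true, if_false, h.orthonormal_scaling]
    by_cases hk : k = k' <;> simp [hk]
  · simp [generator, h.orthogonal]
  · simp only [generator, Bool.false_eq_true, if_false, if_true]
    simp_rw [mul_comm (ψ _)]
    simp [h.orthogonal]
  · simp only [generator, if_true, h.orthonormal_wavelet]
    by_cases hk : k = k' <;> simp [hk]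

/-- A wavelet is orthogonal to all the other wavelets. -/
theorem integral_wavelet_mul_wavelet (h : IsRegularWaveletPair N φ ψ) (n n' : ℕ) (k k' : ℤ) :
    ∫ x : ℝ, ψ ((2 : ℝ) ^ n * x - k) * ψ ((2 : ℝ) ^ n' * x - k') =
      if n = n' ∧ k = k' then ((2 : ℝ) ^ n)⁻¹ else 0 := by
  rcases lt_trichotomy n n' with hn | rfl | hn
  · rw [if_neg fun H => hn.ne H.1]
    exact h.integral_generator_mul_wavelet_of_lt true hn k k'
  · simpa [generator] using h.integral_generator_mul_generator true true n k k'
  · rw [if_neg fun H => hn.ne' H.1]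
    simp_rw [mul_comm (ψ ((2 : ℝ) ^ n * _ - _))]
    exact h.integral_generator_mul_wavelet_of_lt true hn k' k

theorem integral_polynomial_mul_wavelet (h : IsRegularWaveletPair N φ ψ) (P : Polynomial ℝ)
    (hP : P.natDegree ≤ N) : ∫ x : ℝ, P.eval x * ψ x = 0 := by
  have hint : ∀ n : ℕ, Integrable fun x : ℝ => x ^ n * ψ x := fun n => by
    simpa [generator] using h.integrable_generator_mul true 0 0 (F := fun x => x ^ n) (by fun_prop)
  simp_rw [Polynomial.eval_eq_sum_range, Finset.sum_mul, mul_assoc]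
  rw [integral_finsetSum _ fun n _ => (hint n).const_mul _]
  refine Finset.sum_eq_zero fun n hn => ?_
  rw [integral_const_mul, h.vanishing_moments n, mul_zero]
  exact (Nat.lt_succ_iff.1 (Finset.mem_range.1 hn)).trans hP

theorem integral_pow_mul_wavelet_dyadic (h : IsRegularWaveletPair N φ ψ) {n : ℕ} (hn : n ≤ N)
    (j : ℕ) (k x₀ : ℝ) : ∫ x : ℝ, (x - x₀) ^ n * ψ ((2 : ℝ) ^ j * x - k) = 0 := by
  have h2 : ((2 : ℝ) ^ j) ≠ 0 := by positivity
  let P : Polynomial ℝ := (Polynomial.C ((2 : ℝ) ^ j)⁻¹ * Polynomial.X +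
    Polynomial.C (((2 : ℝ) ^ j)⁻¹ * k - x₀)) ^ n
  have hP : P.natDegree ≤ N := by
    refine (Polynomial.natDegree_pow_le_of_le n (m := 1) ?_).trans (by simpa using hn)
    exact Polynomial.natDegree_linear_le
  have := integral_comp_dyadic (fun x => P.eval x * ψ x) j k
  rw [h.integral_polynomial_mul_wavelet P hP, mul_zero] at this
  rw [← this]
  refine integral_congr_ae (ae_of_all _ fun x => ?_)
  simp only [P, Polynomial.eval_pow, Polynomial.eval_add, Polynomial.eval_mul, Polynomial.eval_C,
    Polynomial.eval_X]
  congr 2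
  field_simp
  ring

/-- The sums of the absolute values of the integer translates of the generating functions are
bounded. -/
theorem exists_sum_abs_le (h : IsRegularWaveletPair N φ ψ) : ∃ S : ℝ, 0 ≤ S ∧
    ∀ (b : Bool) (n : ℕ) (t : ℝ), ∑ k : Fin n, |generator φ ψ b (t - ((k : ℕ) : ℝ))| ≤ S := by
  obtain ⟨R, C, hR, hC, hsupp, hbd⟩ := h.exists_bound
  refine ⟨(2 * R + 1) * C, by positivity, fun b n t => ?_⟩
  rw [Fin.sum_univ_eq_sum_range (fun k => |generator φ ψ b (t - (k : ℝ))|) n]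
  -- Only the integers of `[t - R, t + R]` contribute, whatever `n` is.
  have hcard : (((Finset.range n).filter (fun k : ℕ => |t - (k : ℝ)| ≤ R)).card : ℝ)
      ≤ 2 * R + 1 := by
    have h1 : ((Finset.range n).filter (fun k : ℕ => |t - (k : ℝ)| ≤ R)).card ≤
        (Finset.Icc ⌈t - R⌉ ⌊t + R⌋).card := by
      refine Finset.card_le_card_of_injOn (fun k : ℕ => (k : ℤ)) ?_ Nat.cast_injective.injOn
      intro k hk
      have hk' := (Finset.mem_filter.1 (Finset.mem_coe.1 hk)).2
      rw [abs_le] at hk'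
      simp only [Finset.coe_Icc, Set.mem_Icc, Int.ceil_le, Int.le_floor, Int.cast_natCast]
      constructor <;> linarith
    rw [Int.card_Icc] at h1
    have h2 : ((⌊t + R⌋ + 1 - ⌈t - R⌉).toNat : ℝ) ≤ 2 * R + 1 := by
      have h3 := Int.floor_le (t + R)
      have h4 := Int.le_ceil (t - R)
      have h5 : ((⌊t + R⌋ + 1 - ⌈t - R⌉ : ℤ) : ℝ) ≤ 2 * R + 1 := by
        push_cast
        linarith
      have h6 : ((⌊t + R⌋ + 1 - ⌈t - R⌉).toNat : ℝ) =
          ((max (⌊t + R⌋ + 1 - ⌈t - R⌉) 0 : ℤ) : ℝ) := by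
        exact_mod_cast congrArg (Int.cast (R := ℝ)) (Int.toNat_eq_max (⌊t + R⌋ + 1 - ⌈t - R⌉))
      rw [h6]
      rcases max_choice (⌊t + R⌋ + 1 - ⌈t - R⌉) 0 with h7 | h7 <;> rw [h7]
      · exact h5
      · simp; positivity
    exact (Nat.cast_le.2 h1).trans h2
  calc ∑ k ∈ Finset.range n, |generator φ ψ b (t - (k : ℝ))|
      = ∑ k ∈ (Finset.range n).filter (fun k : ℕ => |t - (k : ℝ)| ≤ R),
          |generator φ ψ b (t - (k : ℝ))| := by
        symm
        refine Finset.sum_filter_of_ne fun k _ hk => ?_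
        by_contra hlt
        exact hk (by rw [hsupp b _ (not_le.1 hlt), abs_zero])
    _ ≤ ((Finset.range n).filter (fun k : ℕ => |t - (k : ℝ)| ≤ R)).card • C :=
        Finset.sum_le_card_nsmul _ _ _ fun k _ => hbd b _
    _ ≤ (2 * R + 1) * C := by
        rw [nsmul_eq_mul]
        gcongr

end IsRegularWaveletPair

/-! ### Integration of series against a test function -/

/-- Fubini for series: the uniform bound on the absolute partial sums gives `∑ ∫ |F i * θ| ≤ C ∫
|θ|`. It allows wavelet series to be integrated term by term. -/
theorem hasSum_integral_mul_of_sum_abs_le {X ι : Type*} [MeasurableSpace X] {μ : Measure X}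
    [Countable ι] {F : ι → X → ℝ} {f θ : X → ℝ} {C : ℝ}
    (hF : ∀ i, AEStronglyMeasurable (F i) μ) (hsum : ∀ x, HasSum (fun i => F i x) (f x))
    (hbd : ∀ (u : Finset ι) x, ∑ i ∈ u, |F i x| ≤ C) (hθ : Integrable θ μ) :
    HasSum (fun i => ∫ x, F i x * θ x ∂μ) (∫ x, f x * θ x ∂μ) := by
  have hint : ∀ i, Integrable (fun x => F i x * θ x) μ := fun i => by
    refine hθ.bdd_mul (hF i) (c := C) (ae_of_all _ fun x => ?_)
    simpa using hbd {i} x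
  have hnorm : Summable fun i => ∫ x, ‖F i x * θ x‖ ∂μ := by
    refine summable_of_sum_le (c := C * ∫ x, ‖θ x‖ ∂μ)
      (fun i => integral_nonneg fun x => norm_nonneg _) fun u => ?_
    rw [← integral_finsetSum _ fun i _ => (hint i).norm, ← integral_const_mul]
    refine integral_mono (integrable_finsetSum _ fun i _ => (hint i).norm)
      (hθ.norm.const_mul C) fun x => ?_
    simp only [norm_mul, ← Finset.sum_mul]
    exact mul_le_mul_of_nonneg_right (hbd u x) (norm_nonneg _)
  have := hasSum_integral_of_summable_integral_norm hint hnorm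
  simpa only [fun x => ((hsum x).mul_right (θ x)).tsum_eq] using this

/-! ### Tensor wavelets -/

namespace IsRegularWaveletPair

variable {N D : ℕ} {φ ψ : ℝ → ℝ}

theorem continuous_tensorWavelet (h : IsRegularWaveletPair N φ ψ) (lam : WaveletIndex D) :
    Continuous (tensorWavelet φ ψ lam) := by
  refine continuous_finsetProd _ fun i _ => ?_
  exact (h.continuous_generator_dyadic (lam.2.2.1 i) _ _).comp (continuous_apply i)

theorem integrable_tensorWavelet (h : IsRegularWaveletPair N φ ψ) (lam : WaveletIndex D) :
    Integrable (tensorWavelet φ ψ lam) := by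
  refine Integrable.fintype_prod (f := fun i t => generator φ ψ (lam.2.2.1 i)
      ((2 : ℝ) ^ (lam.1 : ℕ) * t - ((lam.2.1 i : ℕ) : ℝ))) fun i => ?_
  simpa using h.integrable_generator_mul (lam.2.2.1 i) lam.1 ((lam.2.1 i : ℕ) : ℝ)
    (F := fun _ => 1) continuous_const

theorem integral_tensorWavelet_mul_of_lt (h : IsRegularWaveletPair N φ ψ)
    {lam lam' : WaveletIndex D} (hlt : lam.1 < lam'.1) :
    ∫ x, tensorWavelet φ ψ lam x * tensorWavelet φ ψ lam' x = 0 := by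
  simp only [tensorWavelet_eq_prod, ← Finset.prod_mul_distrib]
  rw [integral_fintype_prod_volume_eq_prod (fun i t =>
    generator φ ψ (lam.2.2.1 i) ((2 : ℝ) ^ (lam.1 : ℕ) * t - ((lam.2.1 i : ℕ) : ℝ)) *
    generator φ ψ (lam'.2.2.1 i) ((2 : ℝ) ^ (lam'.1 : ℕ) * t - ((lam'.2.1 i : ℕ) : ℝ)))]
  -- The finer wavelet has a nonzero type, so in some coordinate its factor is `ψ`, which is
  -- orthogonal to both generators at coarser scales.
  obtain ⟨i, hi⟩ : ∃ i, lam'.2.2.1 i = true := by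
    by_contra! H
    exact lam'.2.2.2 (funext fun i => by simpa using H i)
  refine Finset.prod_eq_zero (Finset.mem_univ i) ?_
  rw [hi]
  exact h.integral_generator_mul_wavelet_of_lt (lam.2.2.1 i) hlt (lam.2.1 i : ℕ) (lam'.2.1 i : ℕ)

/-- Orthogonality of the tensor wavelets. -/
theorem integral_tensorWavelet_mul (h : IsRegularWaveletPair N φ ψ) (lam lam' : WaveletIndex D) :
    ∫ x, tensorWavelet φ ψ lam x * tensorWavelet φ ψ lam' x =
      if lam = lam' then ((2 : ℝ) ^ ((lam.1 : ℕ) * D))⁻¹ else 0 := by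
  rcases lt_trichotomy lam.1 lam'.1 with hlt | heq | hlt
  · rw [h.integral_tensorWavelet_mul_of_lt hlt, if_neg]
    rintro rfl
    exact lt_irrefl _ hlt
  · obtain ⟨j, k, l⟩ := lam
    obtain ⟨j', k', l'⟩ := lam'
    obtain rfl : j = j' := heq
    simp only [tensorWavelet_eq_prod, ← Finset.prod_mul_distrib]
    rw [integral_fintype_prod_volume_eq_prod (fun i t =>
      generator φ ψ (l.1 i) ((2 : ℝ) ^ (j : ℕ) * t - ((k i : ℕ) : ℝ)) *
      generator φ ψ (l'.1 i) ((2 : ℝ) ^ (j : ℕ) * t - ((k' i : ℕ) : ℝ)))]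
    have key := fun i => h.integral_generator_mul_generator (l.1 i) (l'.1 i) j
      ((k i : ℕ) : ℤ) ((k' i : ℕ) : ℤ)
    simp only [Int.cast_natCast] at key
    rw [Finset.prod_congr rfl fun i _ => key i]
    by_cases heq' : k = k' ∧ l = l'
    · obtain ⟨rfl, rfl⟩ := heq'
      simp [pow_mul]
    · have hex : ∃ i, ¬ (l.1 i = l'.1 i ∧ ((k i : ℕ) : ℤ) = ((k' i : ℕ) : ℤ)) := by
        by_contra! H
        refine heq' ⟨funext fun i => Fin.ext ?_, Subtype.ext (funext fun i => (H i).1)⟩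
        exact_mod_cast (H i).2
      obtain ⟨i, hi⟩ := hex
      rw [Finset.prod_eq_zero (Finset.mem_univ i) (if_neg hi), if_neg]
      rintro heq''
      simp only [Sigma.mk.injEq, heq_eq_eq, true_and, Prod.mk.injEq] at heq''
      exact heq' heq''
  · simp_rw [mul_comm (tensorWavelet φ ψ lam _)]
    rw [h.integral_tensorWavelet_mul_of_lt hlt, if_neg]
    rintro rfl
    exact lt_irrefl _ hlt

/-- At each scale, the sum of the absolute values of the wavelets is bounded. -/
theorem exists_sum_tensorWavelet_le (h : IsRegularWaveletPair N φ ψ) (D : ℕ) :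
    ∃ S : ℝ, 0 ≤ S ∧ ∀ (j : ℕ+) (x : Fin D → ℝ),
      ∑ kl : ScaleIndex D j, |tensorWavelet φ ψ ⟨j, kl⟩ x| ≤ S := by
  obtain ⟨S, hS, hS'⟩ := h.exists_sum_abs_le
  refine ⟨Fintype.card {l : Fin D → Bool // l ≠ fun _ => false} • S ^ D, by positivity,
    fun j x => ?_⟩
  rw [Fintype.sum_prod_type_right]
  refine Finset.sum_le_card_nsmul _ _ _ fun l _ => ?_
  calc ∑ k : Fin D → Fin (2 ^ (j : ℕ)), |tensorWavelet φ ψ ⟨j, k, l⟩ x|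
      = ∏ i, ∑ n : Fin (2 ^ (j : ℕ)),
          |generator φ ψ (l.1 i) ((2 : ℝ) ^ (j : ℕ) * x i - ((n : ℕ) : ℝ))| := by
        rw [Finset.prod_univ_sum, Fintype.piFinset_univ]
        refine Finset.sum_congr rfl fun k _ => ?_
        rw [tensorWavelet_eq_prod, Finset.abs_prod]
    _ ≤ ∏ _i : Fin D, S :=
        Finset.prod_le_prod (fun i _ => Finset.sum_nonneg fun _ _ => abs_nonneg _)
          fun i _ => hS' _ _ _
    _ = S ^ D := by simp

end IsRegularWaveletPair

/-! ### The embedding of the Besov space into the bounded continuous functions -/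

theorem besovLevel_rpow_le_besovSeqNorm {D : ℕ} {s p : ℝ} (hp : 0 < p) {q : ℝ≥0∞} (hq : 0 < q)
    (c : WaveletIndex D → ℝ) (j : ℕ+) :
    besovLevel s p c j ^ (1 / p) ≤ besovSeqNorm s p q c := by
  by_cases hq' : q = ⊤
  · rw [besovSeqNorm, if_pos hq']
    exact le_iSup (fun j => besovLevel s p c j ^ (1 / p)) j
  · have hqr : 0 < q.toReal := ENNReal.toReal_pos hq.ne' hq'
    rw [besovSeqNorm, if_neg hq']
    calc besovLevel s p c j ^ (1 / p) = (besovLevel s p c j ^ (q.toReal / p)) ^ (1 / q.toReal) := by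
          rw [← ENNReal.rpow_mul]
          congr 1
          field_simp
      _ ≤ _ := ENNReal.rpow_le_rpow (ENNReal.le_tsum j) (by positivity)

theorem abs_coeff_le_of_besovSeqNorm_lt_top {D : ℕ} {s p : ℝ} (hp : 0 < p) {q : ℝ≥0∞} (hq : 0 < q)
    {c : WaveletIndex D → ℝ} (hc : besovSeqNorm s p q c < ⊤) (j : ℕ+) (kl : ScaleIndex D j) :
    |c ⟨j, kl⟩| ≤ ((2 : ℝ) ^ (-(s - D / p))) ^ (j : ℕ) * (besovSeqNorm s p q c).toReal := by
  have h1 : (2 : ℝ≥0∞) ^ ((s - D / p) * ((j : ℕ) : ℝ)) * ‖c ⟨j, kl⟩‖ₑ ≤ besovSeqNorm s p q c := by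
    refine le_trans ?_ (besovLevel_rpow_le_besovSeqNorm hp hq c j)
    have h2 : (2 : ℝ≥0∞) ^ ((s * p - D) * ((j : ℕ) : ℝ)) * ‖c ⟨j, kl⟩‖ₑ ^ p ≤
        besovLevel s p c j := by
      unfold besovLevel
      gcongr
      exact Finset.single_le_sum (f := fun kl => ‖c ⟨j, kl⟩‖ₑ ^ p) (fun _ _ => zero_le)
        (Finset.mem_univ kl)
    refine le_trans (le_of_eq ?_) (ENNReal.rpow_le_rpow h2 (by positivity))
    rw [ENNReal.mul_rpow_of_nonneg _ _ (by positivity), ← ENNReal.rpow_mul, ← ENNReal.rpow_mul,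
      mul_one_div_cancel hp.ne', ENNReal.rpow_one]
    congr 2
    field_simp
  have h3 := ENNReal.toReal_mono hc.ne h1
  rw [ENNReal.toReal_mul, ← ENNReal.toReal_rpow, ENNReal.toReal_ofNat, toReal_enorm,
    Real.norm_eq_abs] at h3
  rw [← Real.rpow_natCast, ← Real.rpow_mul (by norm_num), neg_mul, Real.rpow_neg (by norm_num),
    ← div_eq_inv_mul, le_div_iff₀ (by positivity), mul_comm]
  exact h3

/-- The estimates behind the embedding: at each scale, and summed over all scales. -/
theorem IsRegularWaveletPair.exists_sobolev_bound {N D : ℕ} {φ ψ : ℝ → ℝ}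
    (h : IsRegularWaveletPair N φ ψ) {s p : ℝ} (hp : 0 < p) {q : ℝ≥0∞} (hq : 0 < q)
    (hs : 0 < s - D / p) : ∃ C : ℝ, 0 ≤ C ∧ ∀ c : WaveletIndex D → ℝ, besovSeqNorm s p q c < ⊤ →
      (∀ (j : ℕ+) x, ∑ kl : ScaleIndex D j, |c ⟨j, kl⟩ * tensorWavelet φ ψ ⟨j, kl⟩ x| ≤
        C * ((2 : ℝ) ^ (-(s - D / p))) ^ (j : ℕ) * (besovSeqNorm s p q c).toReal) ∧
      ∀ (u : Finset (WaveletIndex D)) x, ∑ lam ∈ u, |c lam * tensorWavelet φ ψ lam x| ≤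
        C * (besovSeqNorm s p q c).toReal := by
  obtain ⟨S, hS, hS'⟩ := h.exists_sum_tensorWavelet_le D
  set r : ℝ := (2 : ℝ) ^ (-(s - D / p)) with hr
  have hr0 : 0 < r := by positivity
  have hr1 : r < 1 := Real.rpow_lt_one_of_one_lt_of_neg (by norm_num) (by linarith)
  have hgeom := summable_geometric_of_lt_one hr0.le hr1
  have hlevel : ∀ c : WaveletIndex D → ℝ, besovSeqNorm s p q c < ⊤ → ∀ (j : ℕ+) x,
      ∑ kl : ScaleIndex D j, |c ⟨j, kl⟩ * tensorWavelet φ ψ ⟨j, kl⟩ x| ≤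
        S * r ^ (j : ℕ) * (besovSeqNorm s p q c).toReal := by
    intro c hc j x
    calc ∑ kl : ScaleIndex D j, |c ⟨j, kl⟩ * tensorWavelet φ ψ ⟨j, kl⟩ x|
        ≤ ∑ kl : ScaleIndex D j, r ^ (j : ℕ) * (besovSeqNorm s p q c).toReal *
            |tensorWavelet φ ψ ⟨j, kl⟩ x| := by
          refine Finset.sum_le_sum fun kl _ => ?_
          rw [abs_mul]
          gcongr
          exact abs_coeff_le_of_besovSeqNorm_lt_top hp hq hc j kl
      _ ≤ r ^ (j : ℕ) * (besovSeqNorm s p q c).toReal * S := by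
          rw [← Finset.mul_sum]
          gcongr
          exact hS' j x
      _ = _ := by ring
  -- The maximum with `1` lets the same constant serve one scale and the sum over all scales.
  refine ⟨S * max 1 (∑' j : ℕ, r ^ j), by positivity, fun c hc => ⟨fun j x => ?_, fun u x => ?_⟩⟩
  · refine (hlevel c hc j x).trans ?_
    gcongr
    exact le_mul_of_one_le_right hS (le_max_left _ _)
  · calc ∑ lam ∈ u, |c lam * tensorWavelet φ ψ lam x|
        ≤ ∑ lam ∈ (u.image Sigma.fst).sigma fun j => (Finset.univ : Finset (ScaleIndex D j)),
            |c lam * tensorWavelet φ ψ lam x| := by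
          refine Finset.sum_le_sum_of_subset_of_nonneg (fun lam hlam => ?_)
            fun _ _ _ => abs_nonneg _
          simp only [Finset.mem_sigma, Finset.mem_univ, and_true]
          exact Finset.mem_image_of_mem _ hlam
      _ = ∑ j ∈ u.image Sigma.fst, ∑ kl : ScaleIndex D j,
            |c ⟨j, kl⟩ * tensorWavelet φ ψ ⟨j, kl⟩ x| := Finset.sum_sigma _ _ _
      _ ≤ ∑ j ∈ u.image Sigma.fst, S * r ^ (j : ℕ) * (besovSeqNorm s p q c).toReal :=
          Finset.sum_le_sum fun j _ => hlevel c hc j x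
      _ = S * (∑ j ∈ u.image Sigma.fst, r ^ (j : ℕ)) * (besovSeqNorm s p q c).toReal := by
          rw [Finset.mul_sum, Finset.sum_mul]
      _ ≤ _ := by
          gcongr
          refine le_trans ?_ (le_max_right _ _)
          have hmap := Finset.sum_map (u.image Sigma.fst) ⟨PNat.val, PNat.coe_injective⟩
            (fun j : ℕ => r ^ j)
          exact hmap.symm.le.trans (hgeom.sum_le_tsum _ fun _ _ => by positivity)

/-- Orthogonality makes the expansion unique. This ties the coefficients whose existence defines
membership in the space to the integrals from which the quasi-norm is computed. -/
theorem IsRegularWaveletPair.waveletCoeff_eq_of_hasSum {N D : ℕ} {φ ψ : ℝ → ℝ}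
    (h : IsRegularWaveletPair N φ ψ) {s p : ℝ} (hp : 0 < p) {q : ℝ≥0∞} (hq : 0 < q)
    (hs : 0 < s - D / p) {f : (Fin D → ℝ) → ℝ} {c : WaveletIndex D → ℝ}
    (hc : besovSeqNorm s p q c < ⊤)
    (hf : ∀ x, HasSum (fun lam => c lam * tensorWavelet φ ψ lam x) (f x)) :
    waveletCoeff φ ψ f = c := by
  obtain ⟨C, -, hC⟩ := h.exists_sobolev_bound hp hq hs
  funext lam
  have h1 := hasSum_integral_mul_of_sum_abs_le (μ := volume)
    (fun lam => (continuous_const.mul (h.continuous_tensorWavelet lam)).aestronglyMeasurable)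
    hf (hC c hc).2 (h.integrable_tensorWavelet lam)
  have h2 : HasSum (fun lam' => ∫ x, c lam' * tensorWavelet φ ψ lam' x * tensorWavelet φ ψ lam x)
      (∫ x, c lam * tensorWavelet φ ψ lam x * tensorWavelet φ ψ lam x) := by
    refine hasSum_single lam fun lam' hne => ?_
    simp_rw [mul_assoc]
    rw [integral_const_mul, h.integral_tensorWavelet_mul, if_neg hne, mul_zero]
  rw [waveletCoeff, h1.unique h2]
  simp_rw [mul_assoc]
  rw [integral_const_mul, h.integral_tensorWavelet_mul, if_pos rfl]
  field_simp

namespace BesovSpace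

variable {N D : ℕ} {φ ψ : ℝ → ℝ} {s p : ℝ} {hp : 0 < p} {q : ℝ≥0∞} {hq : 0 < q}

theorem quasiNorm_lt_top (h : IsRegularWaveletPair N φ ψ) (hs : 0 < s - D / p)
    (f : BesovSpace D φ ψ s hp hq) : f.quasiNorm < ⊤ := by
  obtain ⟨c, hc, hf⟩ := f.2
  rw [quasiNorm, toFun, h.waveletCoeff_eq_of_hasSum hp hq hs hc hf]
  exact hc

theorem hasSum_toFun (h : IsRegularWaveletPair N φ ψ) (hs : 0 < s - D / p)
    (f : BesovSpace D φ ψ s hp hq) (x : Fin D → ℝ) :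
    HasSum (fun lam => waveletCoeff φ ψ f.toFun lam * tensorWavelet φ ψ lam x) (f.toFun x) := by
  obtain ⟨c, hc, hf⟩ := f.2
  have := h.waveletCoeff_eq_of_hasSum hp hq hs hc hf
  rw [toFun, this]
  exact hf x

theorem exists_abs_toFun_le (h : IsRegularWaveletPair N φ ψ) (hs : 0 < s - D / p)
    (hp : 0 < p) (hq : 0 < q) :
    ∃ C : ℝ, 0 ≤ C ∧ ∀ (f : BesovSpace D φ ψ s hp hq) x, |f.toFun x| ≤ C * f.quasiNorm.toReal := by
  obtain ⟨C, hC0, hC⟩ := h.exists_sobolev_bound hp hq hs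
  refine ⟨C, hC0, fun f x => ?_⟩
  have h1 := (hC _ (f.quasiNorm_lt_top h hs)).2
  refine le_of_tendsto ((f.hasSum_toFun h hs x).abs) (Eventually.of_forall fun u => ?_)
  exact (Finset.abs_sum_le_sum_abs _ _).trans (h1 u x)

theorem continuous_toFun (h : IsRegularWaveletPair N φ ψ) (hs : 0 < s - D / p)
    (f : BesovSpace D φ ψ s hp hq) : Continuous f.toFun := by
  obtain ⟨C, hC0, hC⟩ := h.exists_sobolev_bound hp hq hs
  have h1 := (hC _ (f.quasiNorm_lt_top h hs)).1
  have h2 : f.toFun = fun x => ∑' j : ℕ+, ∑ kl : ScaleIndex D j,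
      waveletCoeff φ ψ f.toFun ⟨j, kl⟩ * tensorWavelet φ ψ ⟨j, kl⟩ x := by
    funext x
    exact ((f.hasSum_toFun h hs x).sigma fun j => hasSum_fintype _).tsum_eq.symm
  rw [h2]
  have hr1 : (2 : ℝ) ^ (-(s - D / p)) < 1 :=
    Real.rpow_lt_one_of_one_lt_of_neg (by norm_num) (by linarith)
  refine continuous_tsum (fun j => ?_)
    (((summable_geometric_of_lt_one (by positivity) hr1).comp_injective
      PNat.coe_injective).mul_left C |>.mul_right
        (besovSeqNorm s p q (waveletCoeff φ ψ f.toFun)).toReal) fun j x => ?_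
  · exact continuous_finsetSum _ fun kl _ => continuous_const.mul (h.continuous_tensorWavelet _)
  · exact (Finset.abs_sum_le_sum_abs _ _).trans (h1 j x)

/-- A bounded additive functional is continuous. -/
theorem continuous_of_abs_sub_le (h : IsRegularWaveletPair N φ ψ) (hs : 0 < s - D / p)
    {L : BesovSpace D φ ψ s hp hq → ℝ} {C : ℝ}
    (hL : ∀ f g, |L f - L g| ≤ C * (f - g).quasiNorm.toReal) : Continuous L := by
  -- Quasi-norm balls need not be open, so openness is checked point by point from its definition;
  -- the triangle inequality is used only in `ℝ`.
  have hball : ∀ y r, IsOpen (L ⁻¹' Metric.ball y r) := ?_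
  · exact ⟨fun U hU => by
      rw [isOpen_iff_forall_mem_open]
      intro f hf
      obtain ⟨r, hr, hrU⟩ := Metric.isOpen_iff.1 hU (L f) hf
      exact ⟨_, Set.preimage_mono hrU, hball _ _, Metric.mem_ball_self hr⟩⟩
  intro y r f hf
  rw [Set.mem_preimage, Metric.mem_ball, Real.dist_eq] at hf
  have hpos : 0 < (r - |L f - y|) / (|C| + 1) := div_pos (by linarith) (by positivity)
  refine ⟨ENNReal.ofReal ((r - |L f - y|) / (|C| + 1)), ENNReal.ofReal_pos.2 hpos, fun g hg => ?_⟩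
  rw [Set.mem_preimage, Metric.mem_ball, Real.dist_eq]
  have h1 : (g - f).quasiNorm.toReal < (r - |L f - y|) / (|C| + 1) :=
    (ENNReal.lt_ofReal_iff_toReal_lt ((g - f).quasiNorm_lt_top h hs).ne).1 hg
  rw [lt_div_iff₀ (by positivity)] at h1
  have h2 : |L g - L f| ≤ (g - f).quasiNorm.toReal * (|C| + 1) := by
    refine (hL g f).trans ?_
    rw [mul_comm]
    gcongr
    linarith [le_abs_self C]
  calc |L g - y| = |(L g - L f) + (L f - y)| := by ring_nf
    _ ≤ |L g - L f| + |L f - y| := abs_add_le _ _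
    _ < r := by linarith

theorem continuous_add_right (g : BesovSpace D φ ψ s hp hq) :
    Continuous fun f : BesovSpace D φ ψ s hp hq => f + g := by
  refine ⟨fun U hU f hf => ?_⟩
  obtain ⟨ε, hε, h'⟩ := hU (f + g) hf
  exact ⟨ε, hε, fun f' hf' => h' (f' + g) (by rwa [add_sub_add_right_eq_sub])⟩

end BesovSpace

/-! ### Wavelet coefficients of the traces -/

/-- The tensor product of the `d` wavelets `ψ (2^j · - kᵢ)`. -/
noncomputable def pureWavelet {d : ℕ} (ψ : ℝ → ℝ) (j : ℕ) (k : Fin d → ℕ) (x : Fin d → ℝ) : ℝ :=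
  ∏ i, ψ ((2 : ℝ) ^ j * x i - (k i : ℝ))

/-- The coefficient of the trace `f_a` on the wavelet `pureWavelet ψ j k`. -/
noncomputable def traceCoeff {d d' : ℕ} (ψ : ℝ → ℝ) (j : ℕ) (k : Fin d → ℕ) (f : (Fin (d + d') → ℝ) → ℝ)
    (a : Fin d' → ℝ) : ℝ :=
  (2 : ℝ) ^ (j * d) * ∫ x : Fin d → ℝ, traceAt f a x * pureWavelet ψ j k x

section TraceCoeff

variable {N d d' : ℕ} {φ ψ : ℝ → ℝ} {s p : ℝ} {hp : 0 < p} {q : ℝ≥0∞} {hq : 0 < q}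

theorem IsRegularWaveletPair.continuous_pureWavelet (h : IsRegularWaveletPair N φ ψ) (j : ℕ)
    (k : Fin d → ℕ) : Continuous (pureWavelet ψ j k) :=
  continuous_finsetProd _ fun i _ =>
    (h.continuous_generator_dyadic true j (k i)).comp (continuous_apply i)

theorem IsRegularWaveletPair.integrable_pureWavelet (h : IsRegularWaveletPair N φ ψ) (j : ℕ)
    (k : Fin d → ℕ) : Integrable (pureWavelet ψ j k) := by
  refine Integrable.fintype_prod (f := fun i t => ψ ((2 : ℝ) ^ j * t - (k i : ℝ))) fun i => ?_
  simpa [generator] using h.integrable_generator_mul true j (k i)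
    (F := fun _ => 1) continuous_const

theorem IsRegularWaveletPair.integral_abs_pureWavelet (j : ℕ) (k : Fin d → ℕ) :
    (2 : ℝ) ^ (j * d) * ∫ x, |pureWavelet ψ j k x| = (∫ t, |ψ t|) ^ d := by
  simp only [pureWavelet, Finset.abs_prod]
  rw [integral_fintype_prod_volume_eq_prod fun i t => |ψ ((2 : ℝ) ^ j * t - (k i : ℝ))|]
  simp_rw [fun i => integral_comp_dyadic (fun t => |ψ t|) j (k i : ℝ)]
  rw [Finset.prod_const, Finset.card_univ, Fintype.card_fin, mul_pow, pow_mul, inv_pow,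
    mul_inv_cancel_left₀ (by positivity)]

theorem BesovSpace.continuous_traceAt (h : IsRegularWaveletPair N φ ψ)
    (hs : 0 < s - ((d + d' : ℕ) : ℝ) / p) (f : BesovSpace (d + d') φ ψ s hp hq) (a : Fin d' → ℝ) :
    Continuous (traceAt f.toFun a) :=
  (f.continuous_toFun h hs).comp ((Fin.continuous_append d d').comp (Continuous.prodMk_left a))

theorem BesovSpace.integrable_traceAt_mul (h : IsRegularWaveletPair N φ ψ)
    (hs : 0 < s - ((d + d' : ℕ) : ℝ) / p) (f : BesovSpace (d + d') φ ψ s hp hq) (a : Fin d' → ℝ)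
    (j : ℕ) (k : Fin d → ℕ) :
    Integrable fun x => traceAt f.toFun a x * pureWavelet ψ j k x := by
  obtain ⟨C, -, hC⟩ := BesovSpace.exists_abs_toFun_le h hs hp hq
  exact (h.integrable_pureWavelet j k).bdd_mul (f.continuous_traceAt h hs a).aestronglyMeasurable
    (ae_of_all _ fun x => hC f _)

theorem BesovSpace.traceCoeff_add (h : IsRegularWaveletPair N φ ψ)
    (hs : 0 < s - ((d + d' : ℕ) : ℝ) / p) (f g : BesovSpace (d + d') φ ψ s hp hq)
    (a : Fin d' → ℝ) (j : ℕ) (k : Fin d → ℕ) :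
    traceCoeff ψ j k (f + g).toFun a = traceCoeff ψ j k f.toFun a + traceCoeff ψ j k g.toFun a := by
  rw [traceCoeff, traceCoeff, traceCoeff, ← mul_add, ← integral_add
    (f.integrable_traceAt_mul h hs a j k) (g.integrable_traceAt_mul h hs a j k)]
  simp_rw [← add_mul]
  rfl

/-- The sup norm is controlled by the quasi-norm, and the normalized `L¹` norm of the wavelet is
`‖ψ‖₁^d`. -/
theorem BesovSpace.continuous_traceCoeff_left (h : IsRegularWaveletPair N φ ψ)
    (hs : 0 < s - ((d + d' : ℕ) : ℝ) / p) (a : Fin d' → ℝ) (j : ℕ) (k : Fin d → ℕ) :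
    Continuous fun f : BesovSpace (d + d') φ ψ s hp hq => traceCoeff ψ j k f.toFun a := by
  obtain ⟨C, hC0, hC⟩ := BesovSpace.exists_abs_toFun_le h hs hp hq
  refine BesovSpace.continuous_of_abs_sub_le h hs (C := (∫ t, |ψ t|) ^ d * C) fun f g => ?_
  have h1 : traceCoeff ψ j k f.toFun a - traceCoeff ψ j k g.toFun a =
      traceCoeff ψ j k (f - g).toFun a := by
    rw [sub_eq_iff_eq_add, ← BesovSpace.traceCoeff_add h hs, sub_add_cancel]
  rw [h1, traceCoeff, abs_mul, abs_of_pos (by positivity : (0 : ℝ) < 2 ^ (j * d)),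
    ← IsRegularWaveletPair.integral_abs_pureWavelet j k, mul_assoc, mul_assoc]
  refine mul_le_mul_of_nonneg_left ?_ (by positivity)
  refine abs_integral_le_integral_abs.trans ?_
  rw [← integral_mul_const]
  refine integral_mono ((f - g).integrable_traceAt_mul h hs a j k).abs
    ((h.integrable_pureWavelet j k).abs.mul_const _) fun x => ?_
  simp only [abs_mul]
  rw [mul_comm]
  exact mul_le_mul_of_nonneg_left (hC (f - g) _) (abs_nonneg _)

theorem BesovSpace.continuous_traceCoeff_right (h : IsRegularWaveletPair N φ ψ)
    (hs : 0 < s - ((d + d' : ℕ) : ℝ) / p) (f : BesovSpace (d + d') φ ψ s hp hq)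
    (j : ℕ) (k : Fin d → ℕ) : Continuous fun a : Fin d' → ℝ => traceCoeff ψ j k f.toFun a := by
  obtain ⟨C, hC0, hC⟩ := BesovSpace.exists_abs_toFun_le h hs hp hq
  refine continuous_const.mul (continuous_of_dominated
    (bound := fun x => C * f.quasiNorm.toReal * |pureWavelet ψ j k x|) (fun a => ?_) (fun a => ?_)
    ((h.integrable_pureWavelet j k).abs.const_mul _) (ae_of_all _ fun x => ?_))
  · exact (f.integrable_traceAt_mul h hs a j k).aestronglyMeasurable
  · refine ae_of_all _ fun x => ?_
    rw [norm_mul]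
    exact mul_le_mul_of_nonneg_right (hC f _) (abs_nonneg _)
  · exact ((f.continuous_toFun h hs).comp
      ((Fin.continuous_append d d').comp (Continuous.prodMk_right x))).mul continuous_const

/-- A Carathéodory function: measurable in `f`, continuous in `a`. Separability is needed only for
the variable `a`, which matters because the Besov space need not be separable. -/
theorem BesovSpace.measurable_traceCoeff (h : IsRegularWaveletPair N φ ψ)
    (hs : 0 < s - ((d + d' : ℕ) : ℝ) / p) (j : ℕ) (k : Fin d → ℕ) :
    Measurable fun y : BesovSpace (d + d') φ ψ s hp hq × (Fin d' → ℝ) =>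
      traceCoeff ψ j k y.1.toFun y.2 := by
  have := measurable_uncurry_of_continuous_of_measurable
    (u := fun (a : Fin d' → ℝ) (f : BesovSpace (d + d') φ ψ s hp hq) =>
      traceCoeff ψ j k f.toFun a)
    (fun f => f.continuous_traceCoeff_right h hs j k)
    fun a => (BesovSpace.continuous_traceCoeff_left h hs a j k).measurable
  exact this.comp measurable_swap

end TraceCoeff

/-! ### Pointwise regularity and decay of the coefficients -/

theorem abs_prod_pow_le_norm_pow {d : ℕ} (y : Fin d → ℝ) (u : Fin d →₀ ℕ) :
    |∏ i, y i ^ u i| ≤ ‖y‖ ^ (∑ i, u i) := by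
  rw [Finset.abs_prod, ← Finset.prod_pow_eq_pow_sum]
  refine Finset.prod_le_prod (fun _ _ => abs_nonneg _) fun i _ => ?_
  rw [abs_pow]
  exact pow_le_pow_left₀ (abs_nonneg _) (norm_le_pi_norm y i) _

/-- The polynomial must be truncated to degree `⌊γ'⌋`; each discarded monomial has degree above
`γ'`, hence is `O(|x - x₀|^γ')`. The lemma serves to bring `γ` below the number of vanishing
moments. -/
theorem IsPointwiseHolder.mono {d : ℕ} {f : (Fin d → ℝ) → ℝ} {γ γ' : ℝ} {x₀ : Fin d → ℝ}
    (hf : IsPointwiseHolder f γ x₀) (h0 : 0 ≤ γ') (hle : γ' ≤ γ) : IsPointwiseHolder f γ' x₀ := by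
  obtain ⟨P, C, -, hC, hev⟩ := hf
  let low := P.support.filter fun u => ∑ i, u i ≤ ⌊γ'⌋₊
  let high := P.support.filter fun u => ¬ ∑ i, u i ≤ ⌊γ'⌋₊
  refine ⟨∑ u ∈ low, MvPolynomial.monomial u (P.coeff u), C + ∑ u ∈ high, |P.coeff u|, ?_,
    by positivity, ?_⟩
  · refine MvPolynomial.totalDegree_finsetSum_le fun u hu => ?_
    refine (MvPolynomial.totalDegree_monomial_le _ _).trans ?_
    rw [Finsupp.sum_fintype _ _ fun _ => rfl]
    exact (Finset.mem_filter.1 hu).2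
  · have hball : ∀ᶠ x in 𝓝 x₀, ‖x - x₀‖ < 1 := by
      filter_upwards [Metric.ball_mem_nhds x₀ one_pos] with x hx
      rwa [Metric.mem_ball, dist_eq_norm] at hx
    filter_upwards [hev, hball] with x hx hx1
    set y := x - x₀
    have hsplit : MvPolynomial.eval y P =
        MvPolynomial.eval y (∑ u ∈ low, MvPolynomial.monomial u (P.coeff u)) +
          ∑ u ∈ high, P.coeff u * ∏ i, y i ^ u i := by
      rw [MvPolynomial.eval_eq', map_sum, ← Finset.sum_filter_add_sum_filter_not P.support
        (fun u => ∑ i, u i ≤ ⌊γ'⌋₊)]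
      congr 1
      refine Finset.sum_congr rfl fun u _ => ?_
      rw [MvPolynomial.eval_monomial, Finsupp.prod_fintype _ _ fun _ => pow_zero _]
    have hhigh : |∑ u ∈ high, P.coeff u * ∏ i, y i ^ u i| ≤
        (∑ u ∈ high, |P.coeff u|) * ‖y‖ ^ γ' := by
      rw [Finset.sum_mul]
      refine (Finset.abs_sum_le_sum_abs _ _).trans (Finset.sum_le_sum fun u hu => ?_)
      rw [abs_mul]
      refine mul_le_mul_of_nonneg_left ((abs_prod_pow_le_norm_pow y u).trans ?_) (abs_nonneg _)
      rw [← Real.rpow_natCast]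
      refine Real.rpow_le_rpow_of_exponent_ge' (norm_nonneg _) hx1.le h0 ?_
      exact (Nat.lt_of_floor_lt (not_le.1 (Finset.mem_filter.1 hu).2)).le
    have hmain : C * ‖y‖ ^ γ ≤ C * ‖y‖ ^ γ' :=
      mul_le_mul_of_nonneg_left
        (Real.rpow_le_rpow_of_exponent_ge' (norm_nonneg _) hx1.le h0 hle) hC.le
    rw [hsplit] at hx
    rw [add_mul]
    calc |f x - MvPolynomial.eval y (∑ u ∈ low, MvPolynomial.monomial u (P.coeff u))|
        = |(f x - (MvPolynomial.eval y (∑ u ∈ low, MvPolynomial.monomial u (P.coeff u)) +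
          ∑ u ∈ high, P.coeff u * ∏ i, y i ^ u i)) +
            ∑ u ∈ high, P.coeff u * ∏ i, y i ^ u i| := by ring_nf
      _ ≤ _ := (abs_add_le _ _).trans (add_le_add (hx.trans hmain) hhigh)

namespace IsRegularWaveletPair

variable {N d : ℕ} {φ ψ : ℝ → ℝ}

/-- Each monomial factors over the coordinates, and one vanishing moment is enough to kill the
product; `d > 0` provides a coordinate. -/
theorem integral_eval_mul_pureWavelet (h : IsRegularWaveletPair N φ ψ) (hd : 0 < d)
    {P : MvPolynomial (Fin d) ℝ} (hP : P.totalDegree ≤ N) (j : ℕ) (k : Fin d → ℕ)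
    (x₀ : Fin d → ℝ) :
    ∫ x, MvPolynomial.eval (x - x₀) P * pureWavelet ψ j k x = 0 := by
  have hexp : ∀ x, MvPolynomial.eval (x - x₀) P * pureWavelet ψ j k x =
      ∑ u ∈ P.support, P.coeff u *
        ∏ i, (x i - x₀ i) ^ u i * ψ ((2 : ℝ) ^ j * x i - (k i : ℝ)) := fun x => by
    rw [MvPolynomial.eval_eq', Finset.sum_mul]
    refine Finset.sum_congr rfl fun u _ => ?_
    rw [Finset.prod_mul_distrib, mul_assoc]
    rfl
  simp_rw [hexp]
  rw [integral_finsetSum]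
  · refine Finset.sum_eq_zero fun u hu => ?_
    rw [integral_const_mul, integral_fintype_prod_volume_eq_prod
      fun i t => (t - x₀ i) ^ u i * ψ ((2 : ℝ) ^ j * t - (k i : ℝ)),
      Finset.prod_eq_zero (Finset.mem_univ (⟨0, hd⟩ : Fin d)), mul_zero]
    refine h.integral_pow_mul_wavelet_dyadic ?_ _ _ _
    refine le_trans ?_ ((MvPolynomial.le_totalDegree hu).trans hP)
    rw [Finsupp.sum_fintype _ _ fun _ => rfl]
    exact Finset.single_le_sum (f := fun i => u i) (fun _ _ => Nat.zero_le _) (Finset.mem_univ _)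
  · intro u _
    refine Integrable.const_mul ?_ _
    refine Integrable.fintype_prod
      (f := fun i t => (t - x₀ i) ^ u i * ψ ((2 : ℝ) ^ j * t - (k i : ℝ))) fun i => ?_
    exact h.integrable_generator_mul true j (k i) (F := fun t => (t - x₀ i) ^ u i) (by fun_prop)

/-- The wavelet coefficients around a point where `g` is `C^γ` decay like the `γ`-th power of
the distance. -/
theorem exists_decay_of_isPointwiseHolder (h : IsRegularWaveletPair N φ ψ) (hd : 0 < d)
    {g : (Fin d → ℝ) → ℝ} (hg : Continuous g) {γ : ℝ} {x₀ : Fin d → ℝ} (hγ : 0 ≤ γ)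
    (hγN : ⌊γ⌋₊ ≤ N) (hgγ : IsPointwiseHolder g γ x₀) :
    ∃ C δ : ℝ, 0 < δ ∧ ∀ (j : ℕ) (k : Fin d → ℕ) (ρ : ℝ), ((2 : ℝ) ^ j)⁻¹ ≤ ρ → ρ ≤ δ →
      (∀ i, |x₀ i - (k i : ℝ) / (2 : ℝ) ^ j| ≤ ρ) →
      |(2 : ℝ) ^ (j * d) * ∫ x, g x * pureWavelet ψ j k x| ≤ C * ρ ^ γ := by
  obtain ⟨P, C, hdeg, hC, hev⟩ := hgγ
  obtain ⟨r, hr, hball⟩ := Metric.eventually_nhds_iff.1 hev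
  obtain ⟨R, -, hR, -, hsupp, -⟩ := h.exists_bound
  -- The wavelet lives within `R 2^{-j} ≤ R ρ` of `k 2^{-j}`, itself within `ρ` of `x₀`, whence `R +
  -- 1`. The factor `2` in `δ` puts the support strictly inside the ball of radius `r`.
  refine ⟨C * (R + 1) ^ γ * (∫ t, |ψ t|) ^ d, r / (2 * (R + 1)), by positivity,
    fun j k ρ hjρ hρ hk => ?_⟩
  have hρ0 : 0 < ρ := lt_of_lt_of_le (by positivity) hjρ
  have hnear : ∀ x, pureWavelet ψ j k x ≠ 0 → ‖x - x₀‖ ≤ (R + 1) * ρ := by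
    intro x hx
    refine (pi_norm_le_iff_of_nonneg (by positivity)).2 fun i => ?_
    have h1 : |(2 : ℝ) ^ j * x i - (k i : ℝ)| ≤ R := by
      by_contra hlt
      exact (Finset.prod_ne_zero_iff.1 hx i (Finset.mem_univ i)) (hsupp true _ (not_le.1 hlt))
    have h2 : |x i - (k i : ℝ) / (2 : ℝ) ^ j| ≤ R * ρ := by
      have h3 : x i - (k i : ℝ) / (2 : ℝ) ^ j =
          ((2 : ℝ) ^ j * x i - (k i : ℝ)) * ((2 : ℝ) ^ j)⁻¹ := by
        field_simp
      rw [h3, abs_mul, abs_of_pos (by positivity : (0 : ℝ) < ((2 : ℝ) ^ j)⁻¹)]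
      gcongr
    have h4 := hk i
    rw [abs_sub_comm] at h4
    rw [Pi.sub_apply, Real.norm_eq_abs]
    calc |x i - x₀ i| = |(x i - (k i : ℝ) / (2 : ℝ) ^ j) + ((k i : ℝ) / (2 : ℝ) ^ j - x₀ i)| := by
          ring_nf
      _ ≤ R * ρ + ρ := (abs_add_le _ _).trans (add_le_add h2 h4)
      _ = (R + 1) * ρ := by ring
  have hcs : HasCompactSupport (pureWavelet ψ j k) := by
    refine HasCompactSupport.intro (isCompact_closedBall x₀ ((R + 1) * ρ)) fun x hx => ?_
    by_contra hne
    exact hx (by rw [Metric.mem_closedBall, dist_eq_norm]; exact hnear x hne)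
  have hPc : Continuous fun x => MvPolynomial.eval (x - x₀) P :=
    (MvPolynomial.continuous_eval P).comp (by fun_prop)
  have hgi : Integrable fun x => g x * pureWavelet ψ j k x :=
    (hg.mul (h.continuous_pureWavelet j k)).integrable_of_hasCompactSupport hcs.mul_left
  have hPi : Integrable fun x => MvPolynomial.eval (x - x₀) P * pureWavelet ψ j k x :=
    (hPc.mul (h.continuous_pureWavelet j k)).integrable_of_hasCompactSupport hcs.mul_left
  have hsub : ∫ x, g x * pureWavelet ψ j k x =
      ∫ x, (g x * pureWavelet ψ j k x - MvPolynomial.eval (x - x₀) P * pureWavelet ψ j k x) := by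
    rw [integral_sub hgi hPi, h.integral_eval_mul_pureWavelet hd (hdeg.trans hγN), sub_zero]
  rw [hsub, abs_mul, abs_of_pos (by positivity : (0 : ℝ) < 2 ^ (j * d)),
    ← integral_abs_pureWavelet j k]
  calc (2 : ℝ) ^ (j * d) * |∫ x, (g x * pureWavelet ψ j k x -
          MvPolynomial.eval (x - x₀) P * pureWavelet ψ j k x)|
      ≤ (2 : ℝ) ^ (j * d) * ∫ x, C * (R + 1) ^ γ * ρ ^ γ * |pureWavelet ψ j k x| := by
        refine mul_le_mul_of_nonneg_left ?_ (by positivity)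
        refine abs_integral_le_integral_abs.trans ?_
        refine integral_mono (hgi.sub hPi).abs ((h.integrable_pureWavelet j k).abs.const_mul _)
          fun x => ?_
        simp only [← sub_mul, abs_mul]
        by_cases hx : pureWavelet ψ j k x = 0
        · simp [hx]
        · refine mul_le_mul_of_nonneg_right ?_ (abs_nonneg _)
          have hx' := hnear x hx
          have hlt : dist x x₀ < r := by
            rw [dist_eq_norm]
            refine lt_of_le_of_lt (hx'.trans (mul_le_mul_of_nonneg_left hρ (by positivity))) ?_
            have : (R + 1) * (r / (2 * (R + 1))) = r / 2 := by field_simp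
            linarith
          refine (hball hlt).trans ?_
          rw [mul_assoc, ← Real.mul_rpow (by positivity) hρ0.le]
          gcongr
    _ = _ := by
        rw [integral_const_mul]
        ring

end IsRegularWaveletPair

/-! ### Excess regularity forces small coefficients at dyadic points -/

/-- At the dyadic point `K 2^{-J}`, for some `K`, the coefficients of the trace `f_a` at the scales
larger than `αJ` are at most `n 2^{-(H + 1/(n+1)) αJ}`. -/
def HasSmallCoeffs {d d' : ℕ} (ψ : ℝ → ℝ) (α H : ℝ) (n J : ℕ) (f : (Fin (d + d') → ℝ) → ℝ)
    (a : Fin d' → ℝ) : Prop :=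
  ∃ K : Fin d → Fin (2 ^ J), ∀ m : ℕ,
    |traceCoeff ψ (⌈α * J⌉₊ + m) (fun i => (K i : ℕ) * 2 ^ (⌈α * J⌉₊ + m - J)) f a| ≤
      n * (2 : ℝ) ^ (-((H + 1 / (n + 1)) * (α * J)))

theorem le_ceil_mul {α : ℝ} (hα : 1 ≤ α) (J : ℕ) : J ≤ ⌈α * J⌉₊ := by
  have h1 : (J : ℝ) ≤ α * J := le_mul_of_one_le_left (Nat.cast_nonneg J) hα
  exact_mod_cast h1.trans (Nat.le_ceil _)

/-- Turns excess regularity at an uncountable family of points `x` into an event described by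
countably many coefficients. -/
theorem BesovSpace.exists_frequently_hasSmallCoeffs {N d d' : ℕ} {φ ψ : ℝ → ℝ} {s p : ℝ}
    {hp : 0 < p} {q : ℝ≥0∞} {hq : 0 < q} (h : IsRegularWaveletPair N φ ψ) (hd : 0 < d)
    (hs : 0 < s - ((d + d' : ℕ) : ℝ) / p) {α H : ℝ} (hα : 1 ≤ α) (hH0 : 0 ≤ H) (hHN : H < N)
    (f : BesovSpace (d + d') φ ψ s hp hq) (a : Fin d' → ℝ) {x : Fin d → ℝ}
    (hx : x ∈ dyadicApprox d α) (hlt : (H : EReal) < holderExponent (traceAt f.toFun a) x) :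
    ∃ n : ℕ, ∃ᶠ J : ℕ in atTop, HasSmallCoeffs (d := d) ψ α H n J f.toFun a := by
  obtain ⟨_, ⟨γ₀, hγ₀, hγ₀', rfl⟩, hHγ₀⟩ := lt_sSup_iff.1 hlt
  rw [EReal.coe_lt_coe_iff] at hHγ₀
  -- The cap at `N` keeps the Taylor polynomial within the vanishing moments; `H < N` keeps `γ`
  -- above `H`.
  set γ := min γ₀ N
  have hHγ : H < γ := lt_min hHγ₀ hHN
  have hγ : IsPointwiseHolder (traceAt f.toFun a) γ x :=
    hγ₀'.mono (hH0.trans hHγ.le) (min_le_left _ _)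
  obtain ⟨C, δ, hδ, hdecay⟩ := h.exists_decay_of_isPointwiseHolder hd
    (f.continuous_traceAt h hs a) (hH0.trans hHγ.le)
    ((Nat.floor_mono (min_le_right _ _)).trans (Nat.floor_natCast N).le) hγ
  obtain ⟨n₁, hn₁⟩ := exists_nat_ge C
  obtain ⟨n₂, hn₂⟩ := exists_nat_one_div_lt (sub_pos.2 hHγ)
  have htend : Tendsto (fun J : ℕ => (2 : ℝ) ^ (-((J : ℝ) * α))) atTop (𝓝 0) := by
    have h1 : Tendsto (fun J : ℕ => ((2 : ℝ) ^ (-α)) ^ J) atTop (𝓝 0) :=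
      tendsto_pow_atTop_nhds_zero_of_lt_one (by positivity)
        (Real.rpow_lt_one_of_one_lt_of_neg (by norm_num) (by linarith))
    refine h1.congr fun J => ?_
    rw [← Real.rpow_natCast, ← Real.rpow_mul (by norm_num)]
    ring_nf
  -- A single integer dominates the constant `C` and makes `1/(n+1)` at most `γ - H`.
  refine ⟨max n₁ n₂, (hx.2.and_eventually (htend.eventually (ge_mem_nhds hδ))).mono ?_⟩
  rintro J ⟨⟨K, hK⟩, hJδ⟩
  refine ⟨K, fun m => ?_⟩
  have hJ : J ≤ ⌈α * J⌉₊ + m := (le_ceil_mul hα J).trans (Nat.le_add_right _ _)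
  set j := ⌈α * J⌉₊ + m
  have hpow : (2 : ℝ) ^ j = 2 ^ (j - J) * 2 ^ J := by rw [← pow_add, Nat.sub_add_cancel hJ]
  have hjρ : ((2 : ℝ) ^ j)⁻¹ ≤ (2 : ℝ) ^ (-((J : ℝ) * α)) := by
    rw [Real.rpow_neg (by norm_num), ← Real.rpow_natCast]
    gcongr
    · norm_num
    · rw [mul_comm]
      refine (Nat.le_ceil _).trans ?_
      exact_mod_cast Nat.le_add_right _ _
  refine (hdecay j _ _ hjρ hJδ fun i => ?_).trans ?_
  · convert hK i using 3
    push_cast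
    rw [hpow]
    field_simp
  · rw [← Real.rpow_mul (by norm_num)]
    refine mul_le_mul (hn₁.trans (by exact_mod_cast le_max_left _ _)) ?_ (by positivity)
      (by positivity)
    refine Real.rpow_le_rpow_of_exponent_le (by norm_num) ?_
    have h1 : H + 1 / (((max n₁ n₂ : ℕ) : ℝ) + 1) ≤ γ := by
      have : 1 / (((max n₁ n₂ : ℕ) : ℝ) + 1) ≤ 1 / ((n₂ : ℝ) + 1) := by
        gcongr
        exact le_max_right _ _
      linarith
    have h2 : 0 ≤ α * J := by positivity
    nlinarith [mul_le_mul_of_nonneg_right h1 h2]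

theorem BesovSpace.measurableSet_exists_frequently_hasSmallCoeffs {N d d' : ℕ} {φ ψ : ℝ → ℝ}
    {s p : ℝ} {hp : 0 < p} {q : ℝ≥0∞} {hq : 0 < q} (h : IsRegularWaveletPair N φ ψ)
    (hs : 0 < s - ((d + d' : ℕ) : ℝ) / p) (α H : ℝ) :
    MeasurableSet {y : BesovSpace (d + d') φ ψ s hp hq × (Fin d' → ℝ) |
      ∃ n : ℕ, ∃ᶠ J : ℕ in atTop, HasSmallCoeffs (d := d) ψ α H n J y.1.toFun y.2} := by
  simp only [HasSmallCoeffs, frequently_atTop, Set.ofPred_exists, Set.ofPred_forall, Set.ofPred_and]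
  refine MeasurableSet.iUnion fun n => MeasurableSet.iInter fun J₀ => MeasurableSet.iUnion fun J =>
    (MeasurableSet.const _).inter (MeasurableSet.iUnion fun K => MeasurableSet.iInter fun m => ?_)
  exact measurableSet_le (BesovSpace.measurable_traceCoeff h hs _ _).abs measurable_const

/-! ### The probe -/

/-- The sum of the `2^{-dJ}`, for those `J ≤ j` such that `k 2^{-j}` is of the form `K 2^{-J}`. -/
noncomputable def dyadicWeight {d : ℕ} (j : ℕ) (k : Fin d → ℕ) : ℝ :=
  ∑ J ∈ Finset.range (j + 1), if ∀ i, 2 ^ (j - J) ∣ k i then ((2 : ℝ) ^ (J * d))⁻¹ else 0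

theorem dyadicWeight_nonneg {d : ℕ} (j : ℕ) (k : Fin d → ℕ) : 0 ≤ dyadicWeight j k :=
  Finset.sum_nonneg fun J _ => by split_ifs <;> positivity

/-- Summing over all generations lets one probe, independent of `α`, be large at the dyadic points
of every generation. -/
theorem le_dyadicWeight {d : ℕ} {j J : ℕ} (hJ : J ≤ j) (K : Fin d → ℕ) :
    ((2 : ℝ) ^ (J * d))⁻¹ ≤ dyadicWeight j fun i => K i * 2 ^ (j - J) := by
  refine le_trans (le_of_eq ?_) (Finset.single_le_sum (fun J _ => ?_)
    (Finset.mem_range.2 (Nat.lt_succ_of_le hJ)))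
  · rw [if_pos fun i => Dvd.intro_left _ rfl]
  · split_ifs <;> positivity

theorem card_filter_dvd_le {j J : ℕ} (hJ : J ≤ j) :
    ((Finset.univ : Finset (Fin (2 ^ j))).filter
      fun n : Fin (2 ^ j) => 2 ^ (j - J) ∣ (n : ℕ)).card ≤ 2 ^ J := by
  rw [← Finset.card_range (2 ^ J)]
  refine Finset.card_le_card_of_injOn (fun n : Fin (2 ^ j) => (n : ℕ) / 2 ^ (j - J)) (fun n _ => ?_) ?_
  · rw [Finset.coe_range, Set.mem_Iio, Nat.div_lt_iff_lt_mul (by positivity), ← pow_add,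
      Nat.add_sub_cancel' hJ]
    exact n.2
  · intro n hn n' hn' heq
    have h1 := (Finset.mem_filter.1 (Finset.mem_coe.1 hn)).2
    have h2 := (Finset.mem_filter.1 (Finset.mem_coe.1 hn')).2
    exact Fin.ext ((Nat.div_left_inj h1 h2).1 heq)

/-- Generation `J` has at most `2^{Jd}` dyadic positions in the first `d` coordinates, each of
weight `2^{-Jd}`, and `2^{jd'}` free positions in the others. Each of the `j + 1` generations thus
contributes at most `2^{jd'}`. -/
theorem sum_dyadicWeight_le (d d' j : ℕ) :
    ∑ k : Fin (d + d') → Fin (2 ^ j), dyadicWeight j (fun i : Fin d => (k (Fin.castAdd d' i) : ℕ)) ≤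
      (j + 1) * (2 : ℝ) ^ (j * d') := by
  simp only [dyadicWeight]
  rw [Finset.sum_comm]
  have key : ∀ J ∈ Finset.range (j + 1), ∑ k : Fin (d + d') → Fin (2 ^ j),
      (if ∀ i : Fin d, 2 ^ (j - J) ∣ (k (Fin.castAdd d' i) : ℕ) then ((2 : ℝ) ^ (J * d))⁻¹ else 0) ≤
        (2 : ℝ) ^ (j * d') := by
    intro J hJ
    have hJ' : J ≤ j := Nat.lt_succ_iff.1 (Finset.mem_range.1 hJ)
    rw [← Finset.sum_filter, Finset.sum_const, nsmul_eq_mul]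
    have hcard : ((Finset.univ : Finset (Fin (d + d') → Fin (2 ^ j))).filter
        fun k => ∀ i : Fin d, 2 ^ (j - J) ∣ (k (Fin.castAdd d' i) : ℕ)).card ≤
          (2 ^ J) ^ d * (2 ^ j) ^ d' := by
      let t : Fin (d + d') → Finset (Fin (2 ^ j)) := Fin.append
        (fun _ : Fin d => Finset.univ.filter fun n : Fin (2 ^ j) => 2 ^ (j - J) ∣ (n : ℕ))
        (fun _ : Fin d' => Finset.univ)
      refine (Finset.card_le_card (t := Fintype.piFinset t) fun k hk => ?_).trans ?_
      · rw [Fintype.mem_piFinset]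
        refine Fin.addCases (fun i => ?_) fun i => ?_
        · simpa [t] using (Finset.mem_filter.1 hk).2 i
        · simp [t]
      · rw [Fintype.card_piFinset, Fin.prod_univ_add]
        simp only [t, Fin.append_left, Fin.append_right, Finset.prod_const, Finset.card_univ,
          Fintype.card_fin]
        gcongr
        exact card_filter_dvd_le hJ'
    calc _ ≤ (((2 ^ J) ^ d * (2 ^ j) ^ d' : ℕ) : ℝ) * ((2 : ℝ) ^ (J * d))⁻¹ := by
          gcongr
      _ = (2 : ℝ) ^ (j * d') := by
          push_cast
          rw [← pow_mul, ← pow_mul]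
          field_simp
  refine (Finset.sum_le_card_nsmul _ _ _ key).trans (le_of_eq ?_)
  rw [Finset.card_range, nsmul_eq_mul]
  push_cast
  rfl

/-- The exponent of the polynomial correction in the coefficients of the probe. -/
noncomputable def probeExponent (p : ℝ) (q : ℝ≥0∞) : ℝ := 1 / p + 2 / q.toReal + 1

/-- The size of the coefficients of the probe. -/
noncomputable def probeAmplitude {d : ℕ} (s p : ℝ) (q : ℝ≥0∞) (j : ℕ) (k : Fin d → ℕ) : ℝ :=
  ((j : ℝ) + 1) ^ (-probeExponent p q) * (2 : ℝ) ^ (-((s - d / p) * j)) *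
    dyadicWeight j k ^ (1 / p)

theorem probeAmplitude_nonneg {d : ℕ} (s p : ℝ) (q : ℝ≥0∞) (j : ℕ) (k : Fin d → ℕ) :
    0 ≤ probeAmplitude s p q j k := by
  have := dyadicWeight_nonneg j k
  unfold probeAmplitude
  positivity

/-- The wavelet coefficients of the probe of parameter `z`. -/
noncomputable def probeCoeff (d d' : ℕ) (s p : ℝ) (q : ℝ≥0∞) (z : ℕ → ℝ)
    (lam : WaveletIndex (d + d')) : ℝ :=
  if lam.2.2.1 = fun _ => true then
    z lam.1 * probeAmplitude s p q lam.1 fun i : Fin d => (lam.2.1 (Fin.castAdd d' i) : ℕ)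
  else 0

theorem sum_abs_probeCoeff_rpow_le (d d' : ℕ) (s : ℝ) {p : ℝ} (hp : 0 < p) (q : ℝ≥0∞) (z : ℕ → ℝ)
    (j : ℕ+) : ∑ kl, |probeCoeff d d' s p q z ⟨j, kl⟩| ^ p ≤ |z j| ^ p *
      (((j : ℕ) : ℝ) + 1) ^ (1 - probeExponent p q * p) *
        (2 : ℝ) ^ (-((s * p - (d + d' : ℕ)) * ((j : ℕ) : ℝ))) := by
  rw [Fintype.sum_prod_type]
  have hk : ∀ k : Fin (d + d') → Fin (2 ^ (j : ℕ)),
      ∑ l, |probeCoeff d d' s p q z ⟨j, k, l⟩| ^ p ≤ |z j| ^ p *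
        (((j : ℕ) : ℝ) + 1) ^ (-(probeExponent p q * p)) *
          (2 : ℝ) ^ (-((s * p - d) * ((j : ℕ) : ℝ))) *
            dyadicWeight j (fun i : Fin d => (k (Fin.castAdd d' i) : ℕ)) := by
    intro k
    have hw := dyadicWeight_nonneg (j : ℕ) fun i : Fin d => (k (Fin.castAdd d' i) : ℕ)
    by_cases hne : (fun _ : Fin (d + d') => true) ≠ fun _ => false
    · rw [Finset.sum_eq_single (⟨_, hne⟩ : {l : Fin (d + d') → Bool // l ≠ fun _ => false})]
      · simp only [probeCoeff, if_true]
        rw [abs_mul, abs_of_nonneg (probeAmplitude_nonneg _ _ _ _ _), probeAmplitude,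
          Real.mul_rpow (abs_nonneg _) (by positivity),
          Real.mul_rpow (by positivity) (by positivity),
          Real.mul_rpow (by positivity) (by positivity), ← Real.rpow_mul (by positivity),
          ← Real.rpow_mul (by positivity), ← Real.rpow_mul hw, one_div_mul_cancel hp.ne',
          Real.rpow_one, ← mul_assoc, ← mul_assoc]
        refine le_of_eq ?_
        congr 3
        · ring_nf
        · field_simp
      · intro l _ hl
        rw [probeCoeff, if_neg fun H => hl (Subtype.ext H), abs_zero, Real.zero_rpow hp.ne']
      · intro H
        exact absurd (Finset.mem_univ _) H
    -- This case means `d + d' = 0`: no type is admissible and the sum is zero.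
    · refine le_trans (le_of_eq ?_) (by positivity)
      refine Finset.sum_eq_zero fun l _ => ?_
      rw [probeCoeff, if_neg, abs_zero, Real.zero_rpow hp.ne']
      intro H
      exact l.2 (H.trans (not_not.1 hne))
  refine (Finset.sum_le_sum fun k _ => hk k).trans ?_
  rw [← Finset.mul_sum]
  refine (mul_le_mul_of_nonneg_left (sum_dyadicWeight_le d d' j) (by positivity)).trans
    (le_of_eq ?_)
  have h1 : (((j : ℕ) : ℝ) + 1) ^ (1 - probeExponent p q * p) =
      (((j : ℕ) : ℝ) + 1) ^ (-(probeExponent p q * p)) * (((j : ℕ) : ℝ) + 1) := by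
    rw [sub_eq_neg_add, Real.rpow_add (by positivity), Real.rpow_one]
  have h2 : (2 : ℝ) ^ (-((s * p - (d + d' : ℕ)) * ((j : ℕ) : ℝ))) =
      (2 : ℝ) ^ (-((s * p - d) * ((j : ℕ) : ℝ))) * (2 : ℝ) ^ ((j : ℕ) * d') := by
    rw [← Real.rpow_natCast 2 ((j : ℕ) * d'), ← Real.rpow_add (by norm_num)]
    push_cast
    ring_nf
  rw [h1, h2]
  ring

theorem besovLevel_eq_ofReal {D : ℕ} (s : ℝ) {p : ℝ} (hp : 0 < p) (c : WaveletIndex D → ℝ)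
    (j : ℕ+) : besovLevel s p c j =
      ENNReal.ofReal ((2 : ℝ) ^ ((s * p - D) * ((j : ℕ) : ℝ)) * ∑ kl, |c ⟨j, kl⟩| ^ p) := by
  rw [besovLevel, ENNReal.ofReal_mul (by positivity), ENNReal.ofReal_sum_of_nonneg
    fun _ _ => by positivity, ← ENNReal.ofReal_rpow_of_pos (by norm_num), ENNReal.ofReal_ofNat]
  congr 1
  refine Finset.sum_congr rfl fun kl _ => ?_
  rw [Real.enorm_eq_ofReal_abs, ENNReal.ofReal_rpow_of_nonneg (abs_nonneg _) hp.le]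

/-- The three terms of `probeExponent` are spent as follows: `1/p` absorbs the `j + 1` generations,
`1` absorbs the growth allowed to `z`, and `2/q` remains to make the sum over scales converge. For
`q = ⊤`, `toReal` is `0` and the term `2/q` is `0`, as needed for a supremum. -/
theorem besovLevel_probeCoeff_le (d d' : ℕ) (s : ℝ) {p : ℝ} (hp : 0 < p) (q : ℝ≥0∞) {z : ℕ → ℝ}
    {η : ℝ} (hη : 0 ≤ η) (j : ℕ+) (hz : |z j| ≤ η * (((j : ℕ) : ℝ) + 1)) :
    besovLevel s p (probeCoeff d d' s p q z) j ≤
      ENNReal.ofReal (η ^ p * (((j : ℕ) : ℝ) + 1) ^ (-(2 / q.toReal * p))) := by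
  rw [besovLevel_eq_ofReal s hp]
  refine ENNReal.ofReal_le_ofReal ?_
  refine (mul_le_mul_of_nonneg_left (sum_abs_probeCoeff_rpow_le d d' s hp q z j)
    (by positivity)).trans ?_
  have h1 : |z j| ^ p ≤ η ^ p * (((j : ℕ) : ℝ) + 1) ^ p := by
    rw [← Real.mul_rpow hη (by positivity)]
    exact Real.rpow_le_rpow (abs_nonneg _) hz hp.le
  have h2 : (2 : ℝ) ^ ((s * p - (d + d' : ℕ)) * ((j : ℕ) : ℝ)) *
      (2 : ℝ) ^ (-((s * p - (d + d' : ℕ)) * ((j : ℕ) : ℝ))) = 1 := by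
    rw [← Real.rpow_add (by norm_num), add_neg_cancel, Real.rpow_zero]
  have h3 : (((j : ℕ) : ℝ) + 1) ^ (-(2 / q.toReal * p)) =
      (((j : ℕ) : ℝ) + 1) ^ p * (((j : ℕ) : ℝ) + 1) ^ (1 - probeExponent p q * p) := by
    rw [← Real.rpow_add (by positivity)]
    congr 1
    rw [probeExponent]
    field_simp
    ring
  calc _ = |z j| ^ p * (((j : ℕ) : ℝ) + 1) ^ (1 - probeExponent p q * p) *
        ((2 : ℝ) ^ ((s * p - (d + d' : ℕ)) * ((j : ℕ) : ℝ)) *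
          (2 : ℝ) ^ (-((s * p - (d + d' : ℕ)) * ((j : ℕ) : ℝ)))) := by ring
    _ ≤ η ^ p * (((j : ℕ) : ℝ) + 1) ^ p * (((j : ℕ) : ℝ) + 1) ^ (1 - probeExponent p q * p) := by
        rw [h2, mul_one]
        gcongr
    _ = _ := by rw [h3, mul_assoc]

/-- Allowing `|z j|` to grow like `η (j + 1)` is what yields continuity for the product topology:
differences bounded by `1` at large scales still count as small. -/
theorem exists_besovSeqNorm_probeCoeff_le (d d' : ℕ) (s : ℝ) {p : ℝ} (hp : 0 < p) {q : ℝ≥0∞}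
    (hq : 0 < q) : ∃ C : ℝ≥0∞, C ≠ ⊤ ∧ ∀ (z : ℕ → ℝ) (η : ℝ), 0 ≤ η →
      (∀ j : ℕ+, |z j| ≤ η * (((j : ℕ) : ℝ) + 1)) →
        besovSeqNorm s p q (probeCoeff d d' s p q z) ≤ C * ENNReal.ofReal η := by
  by_cases hq' : q = ⊤
  · refine ⟨1, ENNReal.one_ne_top, fun z η hη hz => ?_⟩
    rw [besovSeqNorm, if_pos hq', one_mul]
    refine iSup_le fun j => ?_
    refine (ENNReal.rpow_le_rpow (besovLevel_probeCoeff_le d d' s hp q hη j (hz j))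
      (by positivity)).trans (le_of_eq ?_)
    rw [hq', ENNReal.toReal_top, div_zero, zero_mul, neg_zero, Real.rpow_zero, mul_one,
      ENNReal.ofReal_rpow_of_nonneg (by positivity) (by positivity), ← Real.rpow_mul hη,
      mul_one_div_cancel hp.ne', Real.rpow_one]
  · have hqr : 0 < q.toReal := ENNReal.toReal_pos hq.ne' hq'
    set S : ℝ≥0∞ := ∑' j : ℕ+, ENNReal.ofReal ((((j : ℕ) : ℝ) + 1) ^ (-2 : ℝ)) with hS
    have hS' : S ≠ ⊤ := by
      have h1 : Summable fun j : ℕ+ => (((j : ℕ) : ℝ) + 1) ^ (-2 : ℝ) := by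
        have h2 : Summable fun n : ℕ => (n : ℝ) ^ (-2 : ℝ) :=
          Real.summable_nat_rpow.2 (by norm_num)
        have h3 := h2.comp_injective (i := fun j : ℕ+ => (j : ℕ) + 1)
          fun a b hab => PNat.coe_injective (Nat.succ_injective hab)
        simpa [Function.comp_def] using h3
      rw [hS, ← ENNReal.ofReal_tsum_of_nonneg (fun j => by positivity) h1]
      exact ENNReal.ofReal_ne_top
    refine ⟨S ^ (1 / q.toReal), ENNReal.rpow_ne_top_of_nonneg (by positivity) hS',
      fun z η hη hz => ?_⟩
    rw [besovSeqNorm, if_neg hq']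
    have h1 : ∑' j, besovLevel s p (probeCoeff d d' s p q z) j ^ (q.toReal / p) ≤
        S * ENNReal.ofReal η ^ q.toReal := by
      rw [hS, ← ENNReal.tsum_mul_right]
      refine ENNReal.tsum_le_tsum fun j => ?_
      refine (ENNReal.rpow_le_rpow (besovLevel_probeCoeff_le d d' s hp q hη j (hz j))
        (by positivity)).trans (le_of_eq ?_)
      rw [ENNReal.ofReal_rpow_of_nonneg (by positivity) (by positivity),
        ENNReal.ofReal_rpow_of_nonneg hη hqr.le, ← ENNReal.ofReal_mul (by positivity),
        Real.mul_rpow (by positivity) (by positivity), ← Real.rpow_mul hη,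
        ← Real.rpow_mul (by positivity), mul_comm]
      congr 3 <;> field_simp
    refine (ENNReal.rpow_le_rpow h1 (by positivity)).trans (le_of_eq ?_)
    rw [ENNReal.mul_rpow_of_nonneg _ _ (by positivity), ← ENNReal.rpow_mul,
      mul_one_div_cancel hqr.ne', ENNReal.rpow_one]

theorem besovSeqNorm_probeCoeff_lt_top (d d' : ℕ) (s : ℝ) {p : ℝ} (hp : 0 < p) {q : ℝ≥0∞}
    (hq : 0 < q) {z : ℕ → ℝ} (hz : ∀ j, |z j| ≤ 1) :
    besovSeqNorm s p q (probeCoeff d d' s p q z) < ⊤ := by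
  obtain ⟨C, hC, h⟩ := exists_besovSeqNorm_probeCoeff_le d d' s hp hq
  refine (h z 1 zero_le_one fun j => ?_).trans_lt (ENNReal.mul_lt_top hC.lt_top
    ENNReal.ofReal_lt_top)
  refine (hz j).trans ?_
  rw [one_mul, le_add_iff_nonneg_left]
  positivity

theorem IsRegularWaveletPair.summable_mul_tensorWavelet {N D : ℕ} {φ ψ : ℝ → ℝ}
    (h : IsRegularWaveletPair N φ ψ) {s p : ℝ} (hp : 0 < p) {q : ℝ≥0∞} (hq : 0 < q)
    (hs : 0 < s - D / p) {c : WaveletIndex D → ℝ} (hc : besovSeqNorm s p q c < ⊤)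
    (x : Fin D → ℝ) : Summable fun lam => c lam * tensorWavelet φ ψ lam x := by
  obtain ⟨C, -, hC⟩ := h.exists_sobolev_bound hp hq hs
  exact Summable.of_abs (summable_of_sum_le (fun _ => abs_nonneg _) fun u => (hC c hc).2 u x)

theorem abs_unitInterval_le (t : unitInterval) : |(t : ℝ)| ≤ 1 := by
  rw [abs_of_nonneg t.2.1]
  exact t.2.2

/-! ### The probe as a continuous map on `[0,1]^ℕ`, and its traces -/

section Probe

variable {N d d' : ℕ} {φ ψ : ℝ → ℝ} {s p : ℝ} {q : ℝ≥0∞}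

/-- The probe: the function `∑_j z_j ∑_k e_{j,k} Ψ_{j,k,(1,…,1)}`, with `z_j ∈ [0,1]`. -/
noncomputable def probe (h : IsRegularWaveletPair N φ ψ) (hp : 0 < p) (hq : 0 < q)
    (hs : 0 < s - ((d + d' : ℕ) : ℝ) / p) (z : ℕ → unitInterval) :
    BesovSpace (d + d') φ ψ s hp hq :=
  ⟨fun x => ∑' lam, probeCoeff d d' s p q (fun j => z j) lam * tensorWavelet φ ψ lam x,
    probeCoeff d d' s p q (fun j => z j),
    besovSeqNorm_probeCoeff_lt_top d d' s hp hq fun j => abs_unitInterval_le (z j),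
    fun x => (h.summable_mul_tensorWavelet hp hq hs
      (besovSeqNorm_probeCoeff_lt_top d d' s hp hq fun j => abs_unitInterval_le (z j)) x).hasSum⟩

theorem hasSum_probe (h : IsRegularWaveletPair N φ ψ) (hp : 0 < p) (hq : 0 < q)
    (hs : 0 < s - ((d + d' : ℕ) : ℝ) / p) (z : ℕ → unitInterval) (x : Fin (d + d') → ℝ) :
    HasSum (fun lam => probeCoeff d d' s p q (fun j => z j) lam * tensorWavelet φ ψ lam x)
      ((probe h hp hq hs z).toFun x) :=
  (h.summable_mul_tensorWavelet hp hq hs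
    (besovSeqNorm_probeCoeff_lt_top d d' s hp hq fun j => abs_unitInterval_le (z j)) x).hasSum

theorem quasiNorm_probe_sub_probe (h : IsRegularWaveletPair N φ ψ) (hp : 0 < p) (hq : 0 < q)
    (hs : 0 < s - ((d + d' : ℕ) : ℝ) / p) (z z' : ℕ → unitInterval) :
    (probe h hp hq hs z - probe h hp hq hs z').quasiNorm =
      besovSeqNorm s p q (probeCoeff d d' s p q fun j => (z j : ℝ) - z' j) := by
  rw [BesovSpace.quasiNorm]
  refine congrArg _ (h.waveletCoeff_eq_of_hasSum hp hq hs
    (besovSeqNorm_probeCoeff_lt_top d d' s hp hq fun j => ?_) fun x => ?_)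
  · rw [abs_le]
    constructor <;> linarith [(z j).2.1, (z j).2.2, (z' j).2.1, (z' j).2.2]
  · refine ((hasSum_probe h hp hq hs z x).sub (hasSum_probe h hp hq hs z' x)).congr_fun ?_
    intro lam
    simp only [probeCoeff]
    split_ifs <;> ring

/-- Product neighbourhoods control finitely many coordinates; the remaining ones are handled by the
decay of the amplitudes. Continuity makes the range of the probe compact. -/
theorem continuous_probe (h : IsRegularWaveletPair N φ ψ) (hp : 0 < p) (hq : 0 < q)
    (hs : 0 < s - ((d + d' : ℕ) : ℝ) / p) :
    Continuous (probe h hp hq hs : (ℕ → unitInterval) → BesovSpace (d + d') φ ψ s hp hq) := by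
  obtain ⟨C, hC, hnorm⟩ := exists_besovSeqNorm_probeCoeff_le d d' s hp hq
  refine ⟨fun U hU => isOpen_iff_mem_nhds.2 fun z hz => ?_⟩
  obtain ⟨ε, hε, hεU⟩ := hU (probe h hp hq hs z) hz
  obtain ⟨η, hη, hηε⟩ : ∃ η : ℝ, 0 < η ∧ C * ENNReal.ofReal η < ε := by
    have h1 : Tendsto (fun η : ℝ => C * ENNReal.ofReal η) (𝓝[>] 0) (𝓝 (C * ENNReal.ofReal 0)) :=
      ENNReal.Tendsto.const_mul (ENNReal.continuous_ofReal.continuousWithinAt) (Or.inr hC)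
    rw [ENNReal.ofReal_zero, mul_zero] at h1
    obtain ⟨η, h2, h3⟩ := ((h1.eventually (gt_mem_nhds hε)).and self_mem_nhdsWithin).exists
    exact ⟨η, h3, h2⟩
  -- Beyond `n > 1/η`, the trivial bound `|z' j - z j| ≤ 1` is already at most `η (j + 1)`.
  obtain ⟨n, hn⟩ := exists_nat_gt (1 / η)
  have hnhds : ∀ᶠ z' in 𝓝 z, ∀ j ∈ Finset.range n, |(z' j : ℝ) - z j| < η := by
    refine (Filter.eventually_all_finset _).2 fun j _ => ?_
    have hcont : Continuous fun z' : ℕ → unitInterval => |(z' j : ℝ) - z j| := by fun_prop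
    exact (hcont.tendsto z).eventually (gt_mem_nhds (by simpa using hη))
  filter_upwards [hnhds] with z' hz'
  refine hεU _ ?_
  rw [quasiNorm_probe_sub_probe]
  refine (hnorm _ η hη.le fun j => ?_).trans_lt hηε
  by_cases hj : (j : ℕ) < n
  · refine (hz' j (Finset.mem_range.2 hj)).le.trans (le_mul_of_one_le_right hη.le ?_)
    rw [le_add_iff_nonneg_left]
    positivity
  · have h1 : |(z' j : ℝ) - z j| ≤ 1 := by
      rw [abs_le]
      constructor <;> linarith [(z j).2.1, (z j).2.2, (z' j).2.1, (z' j).2.2]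
    have h2 : (n : ℝ) ≤ ((j : ℕ) : ℝ) := by exact_mod_cast not_lt.1 hj
    refine h1.trans ?_
    rw [div_lt_iff₀ hη] at hn
    nlinarith

theorem IsRegularWaveletPair.integral_pureWavelet_mul (h : IsRegularWaveletPair N φ ψ)
    (hd : 0 < d) (j j' : ℕ) (k k' : Fin d → ℕ) :
    ∫ x, pureWavelet ψ j k x * pureWavelet ψ j' k' x =
      if j = j' ∧ k = k' then ((2 : ℝ) ^ (j * d))⁻¹ else 0 := by
  simp only [pureWavelet, ← Finset.prod_mul_distrib]
  rw [integral_fintype_prod_volume_eq_prod fun i t =>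
    ψ ((2 : ℝ) ^ j * t - (k i : ℝ)) * ψ ((2 : ℝ) ^ j' * t - (k' i : ℝ))]
  have key := fun i => h.integral_wavelet_mul_wavelet j j' (k i : ℤ) (k' i : ℤ)
  simp only [Int.cast_natCast] at key
  rw [Finset.prod_congr rfl fun i _ => key i]
  by_cases heq : j = j' ∧ k = k'
  · obtain ⟨rfl, rfl⟩ := heq
    simp [pow_mul]
  · rw [if_neg heq]
    have hex : ∃ i, ¬ (j = j' ∧ (k i : ℤ) = (k' i : ℤ)) := by
      by_contra! H
      exact heq ⟨(H ⟨0, hd⟩).1, funext fun i => by exact_mod_cast (H i).2⟩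
    obtain ⟨i, hi⟩ := hex
    exact Finset.prod_eq_zero (Finset.mem_univ i) (if_neg hi)

theorem tensorWavelet_append {lam : WaveletIndex (d + d')} (hl : lam.2.2.1 = fun _ => true)
    (x : Fin d → ℝ) (a : Fin d' → ℝ) :
    tensorWavelet φ ψ lam (Fin.append x a) =
      pureWavelet ψ lam.1 (fun i => (lam.2.1 (Fin.castAdd d' i) : ℕ)) x *
        pureWavelet ψ lam.1 (fun i => (lam.2.1 (Fin.natAdd d i) : ℕ)) a := by
  rw [tensorWavelet_eq_prod, Fin.prod_univ_add]
  simp only [hl, Fin.append_left, Fin.append_right]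
  rfl

/-- The coefficients of the traces of the probe. -/
theorem traceCoeff_probe (h : IsRegularWaveletPair N φ ψ) (hd : 0 < d) (hp : 0 < p) (hq : 0 < q)
    (hs : 0 < s - ((d + d' : ℕ) : ℝ) / p) (z : ℕ → unitInterval) (a : Fin d' → ℝ) (j : ℕ+)
    (k : Fin d → Fin (2 ^ (j : ℕ))) :
    traceCoeff ψ j (fun i => (k i : ℕ)) (probe h hp hq hs z).toFun a =
      z j * probeAmplitude s p q j (fun i => (k i : ℕ)) *
        ∏ i, ∑ n : Fin (2 ^ (j : ℕ)), ψ ((2 : ℝ) ^ (j : ℕ) * a i - ((n : ℕ) : ℝ)) := by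
  obtain ⟨C, -, hC⟩ := h.exists_sobolev_bound hp hq hs
  have hnorm := besovSeqNorm_probeCoeff_lt_top d d' s hp hq fun j => abs_unitInterval_le (z j)
  have h1 := hasSum_integral_mul_of_sum_abs_le (μ := volume)
    (F := fun lam (x : Fin d → ℝ) => probeCoeff d d' s p q (fun j => z j) lam *
      tensorWavelet φ ψ lam (Fin.append x a))
    (fun lam => (continuous_const.mul ((h.continuous_tensorWavelet lam).comp
      ((Fin.continuous_append d d').comp (Continuous.prodMk_left a)))).aestronglyMeasurable)
    (fun x => hasSum_probe h hp hq hs z (Fin.append x a))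
    (fun u x => (hC _ hnorm).2 u (Fin.append x a))
    (h.integrable_pureWavelet (j : ℕ) fun i => (k i : ℕ))
  -- A tensor wavelet of type `(1,…,1)` splits into a wavelet in `x` times one in `a`. Integration
  -- in `x` kills all terms except those of scale `j` and position `k` in the first `d` coordinates.
  have hterm : ∀ lam : WaveletIndex (d + d'), ∫ x : Fin d → ℝ,
      probeCoeff d d' s p q (fun j => z j) lam * tensorWavelet φ ψ lam (Fin.append x a) *
        pureWavelet ψ (j : ℕ) (fun i => (k i : ℕ)) x =
      if lam.2.2.1 = (fun _ => true) ∧ (lam.1 : ℕ) = j ∧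
          (fun i => (lam.2.1 (Fin.castAdd d' i) : ℕ)) = fun i => (k i : ℕ) then
        z j * probeAmplitude s p q j (fun i => (k i : ℕ)) *
          pureWavelet ψ j (fun i => (lam.2.1 (Fin.natAdd d i) : ℕ)) a * ((2 : ℝ) ^ (j * d : ℕ))⁻¹
      else 0 := by
    intro lam
    by_cases hl : lam.2.2.1 = fun _ => true
    · simp_rw [tensorWavelet_append hl]
      have : ∀ x : Fin d → ℝ, probeCoeff d d' s p q (fun j => z j) lam *
          (pureWavelet ψ lam.1 (fun i => (lam.2.1 (Fin.castAdd d' i) : ℕ)) x *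
            pureWavelet ψ lam.1 (fun i => (lam.2.1 (Fin.natAdd d i) : ℕ)) a) *
              pureWavelet ψ (j : ℕ) (fun i => (k i : ℕ)) x =
          probeCoeff d d' s p q (fun j => z j) lam *
            pureWavelet ψ lam.1 (fun i => (lam.2.1 (Fin.natAdd d i) : ℕ)) a *
          (pureWavelet ψ lam.1 (fun i => (lam.2.1 (Fin.castAdd d' i) : ℕ)) x *
            pureWavelet ψ (j : ℕ) (fun i => (k i : ℕ)) x) := fun x => by ring
      simp_rw [this]
      rw [integral_const_mul, h.integral_pureWavelet_mul hd, probeCoeff, if_pos hl]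
      by_cases hcond : (lam.1 : ℕ) = j ∧
          (fun i => (lam.2.1 (Fin.castAdd d' i) : ℕ)) = fun i => (k i : ℕ)
      · rw [if_pos hcond, if_pos ⟨hl, hcond⟩, hcond.2]
        obtain ⟨j', k', l⟩ := lam
        obtain rfl : j' = j := PNat.coe_injective hcond.1
        rfl
      · rw [if_neg hcond, if_neg fun H => hcond H.2, mul_zero]
    · rw [if_neg fun H => hl H.1]
      simp [probeCoeff, hl]
  simp only [hterm] at h1
  have hl : (fun _ : Fin (d + d') => true) ≠ fun _ => false := fun H => by
    simpa using congrFun H ⟨0, by omega⟩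
  -- The surviving indices are parametrized by the position `k'` in the last `d'` coordinates.
  let e : (Fin d' → Fin (2 ^ (j : ℕ))) → WaveletIndex (d + d') := fun k' =>
    ⟨j, Fin.append k k', ⟨fun _ => true, hl⟩⟩
  have he : Function.Injective e := fun k' k'' heq => by
    simp only [e, Sigma.mk.injEq, heq_eq_eq, true_and, Prod.mk.injEq, and_true] at heq
    funext i
    simpa using congrFun heq (Fin.natAdd d i)
  have h2 := (he.hasSum_iff (fun lam hlam => if_neg fun H => hlam ?_)).2 h1
  · rw [traceCoeff]
    have h3 := h2.unique (hasSum_fintype _)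
    have h4 : ∫ x : Fin d → ℝ, traceAt (probe h hp hq hs z).toFun a x *
        pureWavelet ψ (j : ℕ) (fun i => (k i : ℕ)) x =
        ∑ k' : Fin d' → Fin (2 ^ (j : ℕ)), z j * probeAmplitude s p q j (fun i => (k i : ℕ)) *
          pureWavelet ψ j (fun i => (k' i : ℕ)) a * ((2 : ℝ) ^ (j * d : ℕ))⁻¹ := by
      refine h3.trans (Finset.sum_congr rfl fun k' _ => ?_)
      simp only [Function.comp_apply, e, Fin.append_left, Fin.append_right]
      rw [if_pos ⟨trivial, trivial, trivial⟩]
    rw [h4, ← Finset.sum_mul, ← Finset.mul_sum, Finset.prod_univ_sum, Fintype.piFinset_univ]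
    simp only [pureWavelet]
    field_simp
  · obtain ⟨j', k', l, hl'⟩ := lam
    obtain ⟨H1, H2, H3⟩ := H
    obtain rfl : j' = j := PNat.coe_injective H2
    obtain rfl : l = fun _ => true := H1
    refine ⟨fun i => k' (Fin.natAdd d i), ?_⟩
    simp only [e, Sigma.mk.injEq, heq_eq_eq, true_and, Prod.mk.injEq, and_true]
    funext i
    refine Fin.addCases (fun i => ?_) (fun i => ?_) i
    · rw [Fin.append_left]
      exact (Fin.ext (congrFun H3 i)).symm
    · rw [Fin.append_right]

end Probe

/-! ### The periodized wavelet -/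

section Periodized

variable {N : ℕ} {φ ψ : ℝ → ℝ}

theorem periodizedWavelet_add_nat (ψ : ℝ → ℝ) (t : ℝ) (n : ℕ) :
    periodizedWavelet ψ (t + n) = periodizedWavelet ψ t := by
  rw [periodizedWavelet, ← (Equiv.addRight (n : ℤ)).tsum_eq fun k : ℤ => ψ (t + n - k)]
  refine tsum_congr fun k => ?_
  simp only [Equiv.coe_addRight, Int.cast_add, Int.cast_natCast]
  ring_nf

theorem IsRegularWaveletPair.continuous_periodizedWavelet (h : IsRegularWaveletPair N φ ψ) :
    Continuous (periodizedWavelet ψ) := by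
  obtain ⟨R, -, hR, -, hsupp, -⟩ := h.exists_bound
  refine continuous_iff_continuousAt.2 fun t₀ => ?_
  have hev : periodizedWavelet ψ =ᶠ[𝓝 t₀]
      fun t => ∑ k ∈ Finset.Icc ⌊t₀ - R - 1⌋ ⌈t₀ + R + 1⌉, ψ (t - k) := by
    filter_upwards [Metric.ball_mem_nhds t₀ one_pos] with t ht
    rw [Metric.mem_ball, Real.dist_eq, abs_lt] at ht
    refine tsum_eq_sum fun k hk => hsupp true _ ?_
    rw [Finset.mem_Icc, not_and_or, not_le, not_le] at hk
    rcases hk with hk | hk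
    · have : (k : ℝ) < t₀ - R - 1 := lt_of_lt_of_le (Int.cast_lt.2 hk) (Int.floor_le _)
      exact lt_of_lt_of_le (by linarith) (le_abs_self _)
    · have : t₀ + R + 1 < k := lt_of_le_of_lt (Int.le_ceil _) (Int.cast_lt.2 hk)
      exact lt_of_lt_of_le (by linarith) (neg_le_abs _)
  refine ContinuousAt.congr (Continuous.continuousAt ?_) hev.symm
  exact continuous_finsetSum _ fun k _ =>
    h.contDiff_wavelet.continuous.comp (continuous_id.sub continuous_const)

/-- In the open unit interval, the boundary is not seen by the wavelets at small scales. -/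
theorem IsRegularWaveletPair.eventually_sum_eq_periodizedWavelet (h : IsRegularWaveletPair N φ ψ)
    {t : ℝ} (ht : t ∈ Set.Ioo (0 : ℝ) 1) : ∀ᶠ j : ℕ in atTop,
      ∑ n : Fin (2 ^ j), ψ ((2 : ℝ) ^ j * t - ((n : ℕ) : ℝ)) =
        periodizedWavelet ψ ((2 : ℝ) ^ j * t) := by
  obtain ⟨R, -, hR, -, hsupp, -⟩ := h.exists_bound
  have hpow : Tendsto (fun j : ℕ => (2 : ℝ) ^ j) atTop atTop :=
    tendsto_pow_atTop_atTop_of_one_lt (by norm_num)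
  filter_upwards [(hpow.atTop_mul_const ht.1).eventually_gt_atTop R,
    (hpow.atTop_mul_const (sub_pos.2 ht.2)).eventually_gt_atTop R] with j h1 h2
  rw [Fin.sum_univ_eq_sum_range (fun n : ℕ => ψ ((2 : ℝ) ^ j * t - (n : ℝ))) (2 ^ j),
    periodizedWavelet, tsum_eq_sum (s := (Finset.range (2 ^ j)).map Nat.castEmbedding)]
  · rw [Finset.sum_map]
    simp
  · intro k hk
    refine hsupp true _ ?_
    have hk' : k < 0 ∨ (2 : ℤ) ^ j ≤ k := by
      by_contra! H
      obtain ⟨n, rfl⟩ := Int.eq_ofNat_of_zero_le H.1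
      refine hk (Finset.mem_map.2 ⟨n, Finset.mem_range.2 ?_, rfl⟩)
      exact_mod_cast H.2
    rcases hk' with hk' | hk'
    · have h3 : (k : ℝ) < 0 := by exact_mod_cast hk'
      exact lt_of_lt_of_le (by linarith) (le_abs_self _)
    · have h3 : (2 : ℝ) ^ j ≤ k := by exact_mod_cast hk'
      exact lt_of_lt_of_le (by linarith) (neg_le_abs _)

/-- The periodized wavelet is bounded below by the distance to a finite set. -/
theorem WaveletHypothesis.exists_finset_abs_sub_le (h : WaveletHypothesis N φ ψ) :
    ∃ (Z : Finset ℝ) (C : ℝ), 0 ≤ C ∧ ∀ t ∈ Set.Icc (0 : ℝ) 1, ∃ z ∈ Z,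
      |t - z| ≤ C * |periodizedWavelet ψ t| := by
  -- Compactness reduces the claim to a neighbourhood of each point `t₀`, where `Z = {t₀}` suffices.
  refine isCompact_Icc.induction_on (p := fun S : Set ℝ => ∃ (Z : Finset ℝ) (C : ℝ), 0 ≤ C ∧
    ∀ t ∈ S, ∃ z ∈ Z, |t - z| ≤ C * |periodizedWavelet ψ t|) ?_ ?_ ?_ ?_
  · exact ⟨∅, 0, le_rfl, fun t ht => ht.elim⟩
  · rintro S S' hSS' ⟨Z, C, hC, hS'⟩
    exact ⟨Z, C, hC, fun t ht => hS' t (hSS' ht)⟩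
  · rintro S S' ⟨Z, C, hC, hS⟩ ⟨Z', C', hC', hS'⟩
    refine ⟨Z ∪ Z', max C C', le_max_of_le_left hC, fun t ht => ?_⟩
    rcases ht with ht | ht
    · obtain ⟨z, hz, hle⟩ := hS t ht
      refine ⟨z, Finset.mem_union_left _ hz, hle.trans ?_⟩
      exact mul_le_mul_of_nonneg_right (le_max_left _ _) (abs_nonneg _)
    · obtain ⟨z, hz, hle⟩ := hS' t ht
      refine ⟨z, Finset.mem_union_right _ hz, hle.trans ?_⟩
      exact mul_le_mul_of_nonneg_right (le_max_right _ _) (abs_nonneg _)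
  · intro t₀ ht₀
    suffices hsuff : ∃ C : ℝ, 0 ≤ C ∧ ∀ᶠ t in 𝓝 t₀, |t - t₀| ≤ C * |periodizedWavelet ψ t| by
      obtain ⟨C, hC, hev⟩ := hsuff
      exact ⟨_, mem_nhdsWithin_of_mem_nhds hev, {t₀}, C, hC,
        fun t ht => ⟨t₀, Finset.mem_singleton_self _, ht⟩⟩
    by_cases hzero : periodizedWavelet ψ t₀ = 0
    · set D := deriv (periodizedWavelet ψ) t₀
      have hD : 0 < |D| := h.simple_zeros t₀ ht₀ hzero
      -- Differentiability comes for free: `deriv` takes the value `0` where it fails.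
      have hdiff : HasDerivAt (periodizedWavelet ψ) D t₀ :=
        (differentiableAt_of_deriv_ne_zero (abs_pos.1 hD)).hasDerivAt
      refine ⟨2 / |D|, by positivity, ?_⟩
      have hlittle := (hasDerivAt_iff_isLittleO.1 hdiff).def (half_pos hD)
      filter_upwards [hlittle] with t ht
      rw [hzero, sub_zero, smul_eq_mul, Real.norm_eq_abs, Real.norm_eq_abs] at ht
      have h1 : |(t - t₀) * D| ≤ |periodizedWavelet ψ t| +
          |periodizedWavelet ψ t - (t - t₀) * D| := by
        have := abs_sub (periodizedWavelet ψ t) (periodizedWavelet ψ t - (t - t₀) * D)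
        simpa using this
      rw [abs_mul] at h1
      rw [div_mul_eq_mul_div, le_div_iff₀ hD]
      linarith
    · have hpos : 0 < |periodizedWavelet ψ t₀| := abs_pos.2 hzero
      -- Here `t₀` is not a zero and merely enlarges `Z`: nearby, `|t - t₀| < 1` while the
      -- periodized wavelet stays bounded below.
      refine ⟨2 / |periodizedWavelet ψ t₀|, by positivity, ?_⟩
      have h1 : ∀ᶠ t in 𝓝 t₀, |periodizedWavelet ψ t₀| / 2 < |periodizedWavelet ψ t| :=
        (h.regular.continuous_periodizedWavelet.abs.tendsto t₀).eventually
          (lt_mem_nhds (half_lt_self hpos))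
      filter_upwards [h1, Metric.ball_mem_nhds t₀ one_pos] with t ht ht1
      rw [Metric.mem_ball, Real.dist_eq] at ht1
      refine ht1.le.trans ?_
      rw [div_mul_eq_mul_div, le_div_iff₀ hpos]
      linarith

/-- The map `t ↦ 2^j t` runs through about `2^j` periods, each contributing `|Z|` intervals of
length `2Cδ 2^{-j}`, so the total does not depend on `j`. -/
theorem WaveletHypothesis.exists_volume_le (h : WaveletHypothesis N φ ψ) :
    ∃ C : ℝ, 0 ≤ C ∧ ∀ (j : ℕ) (δ : ℝ), 0 ≤ δ →
      volume {t : ℝ | t ∈ Set.Icc (0 : ℝ) 1 ∧ |periodizedWavelet ψ ((2 : ℝ) ^ j * t)| < δ} ≤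
        ENNReal.ofReal (C * δ) := by
  obtain ⟨Z, C, hC, hZ⟩ := h.exists_finset_abs_sub_le
  refine ⟨4 * C * Z.card, by positivity, fun j δ hδ => ?_⟩
  have h2 : (0 : ℝ) < 2 ^ j := by positivity
  have hsub : {t : ℝ | t ∈ Set.Icc (0 : ℝ) 1 ∧ |periodizedWavelet ψ ((2 : ℝ) ^ j * t)| < δ} ⊆
      -- The extra index accounts for `t = 1`, where the integer part is `2^j`.
      ⋃ y ∈ Finset.range (2 ^ j + 1) ×ˢ Z,
        Metric.closedBall ((y.1 + y.2) / (2 : ℝ) ^ j) (C * δ / 2 ^ j) := by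
    rintro t ⟨ht, hlt⟩
    have hu : 0 ≤ (2 : ℝ) ^ j * t := mul_nonneg h2.le ht.1
    set u := (2 : ℝ) ^ j * t with hu'
    set n := ⌊u⌋₊
    have hn : u = (u - n) + n := by ring
    have hmem : u - n ∈ Set.Icc (0 : ℝ) 1 := by
      constructor
      · linarith [Nat.floor_le hu]
      · linarith [Nat.lt_floor_add_one u]
    obtain ⟨z, hz, hle⟩ := hZ _ hmem
    rw [← periodizedWavelet_add_nat ψ (u - n) n, ← hn] at hle
    have hnle : n ≤ 2 ^ j := by
      have : (n : ℝ) ≤ 2 ^ j := (Nat.floor_le hu).trans (mul_le_of_le_one_right h2.le ht.2)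
      exact_mod_cast this
    refine Set.mem_biUnion (x := (n, z)) ?_ ?_
    · exact Finset.mem_coe.2 (Finset.mem_product.2 ⟨Finset.mem_range.2 (Nat.lt_succ_of_le hnle), hz⟩)
    · rw [Metric.mem_closedBall, Real.dist_eq, le_div_iff₀ h2]
      have h3 : |t - (n + z) / (2 : ℝ) ^ j| * 2 ^ j = |u - n - z| := by
        rw [← abs_of_pos h2, ← abs_mul, abs_of_pos h2, sub_mul, div_mul_cancel₀ _ h2.ne', hu']
        ring_nf
      rw [h3]
      exact hle.trans (mul_le_mul_of_nonneg_left hlt.le hC)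
  calc _ ≤ volume (⋃ y ∈ Finset.range (2 ^ j + 1) ×ˢ Z,
        Metric.closedBall ((y.1 + y.2) / (2 : ℝ) ^ j) (C * δ / 2 ^ j)) := measure_mono hsub
    _ ≤ ∑ y ∈ Finset.range (2 ^ j + 1) ×ˢ Z,
        volume (Metric.closedBall ((y.1 + y.2) / (2 : ℝ) ^ j) (C * δ / 2 ^ j)) :=
        measure_biUnion_finset_le _ _
    _ = ENNReal.ofReal (((2 ^ j + 1 : ℕ) * Z.card : ℕ) * (2 * (C * δ / 2 ^ j))) := by
        simp only [Real.volume_closedBall]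
        rw [Finset.sum_const, Finset.card_product, Finset.card_range, nsmul_eq_mul,
          ENNReal.ofReal_mul (Nat.cast_nonneg _), ENNReal.ofReal_natCast]
    _ ≤ _ := by
        refine ENNReal.ofReal_le_ofReal ?_
        push_cast
        have h3 : ((2 : ℝ) ^ j + 1) / 2 ^ j ≤ 2 := by
          rw [div_le_iff₀ h2]
          linarith [one_le_pow₀ (one_le_two : (1 : ℝ) ≤ 2) (n := j)]
        calc ((2 : ℝ) ^ j + 1) * Z.card * (2 * (C * δ / 2 ^ j))
            = ((2 : ℝ) ^ j + 1) / 2 ^ j * (2 * C * Z.card * δ) := by ring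
          _ ≤ 2 * (2 * C * Z.card * δ) := mul_le_mul_of_nonneg_right h3 (by positivity)
          _ = _ := by ring

/-- Borel–Cantelli with the summable thresholds `(j + 1)^{-2}`. The endpoints are discarded because
only interior points eventually see the full periodization. -/
theorem WaveletHypothesis.ae_eventually_le_abs_sum (h : WaveletHypothesis N φ ψ) :
    ∀ᵐ t : ℝ, t ∈ Set.Icc (0 : ℝ) 1 → ∀ᶠ j : ℕ in atTop, (((j : ℝ) + 1) ^ 2)⁻¹ ≤
      |∑ n : Fin (2 ^ j), ψ ((2 : ℝ) ^ j * t - ((n : ℕ) : ℝ))| := by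
  obtain ⟨C, hC, hvol⟩ := h.exists_volume_le
  have hsum : ∑' j : ℕ, volume {t : ℝ | t ∈ Set.Icc (0 : ℝ) 1 ∧
      |periodizedWavelet ψ ((2 : ℝ) ^ j * t)| < (((j : ℝ) + 1) ^ 2)⁻¹} ≠ ⊤ := by
    have h1 : Summable fun j : ℕ => C * (((j : ℝ) + 1) ^ 2)⁻¹ := by
      refine Summable.mul_left C ?_
      have h2 := (summable_nat_add_iff 1).2 (Real.summable_nat_pow_inv.2 one_lt_two)
      simpa using h2
    refine ne_top_of_le_ne_top ?_ (ENNReal.tsum_le_tsum fun j => hvol j _ (by positivity))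
    rw [← ENNReal.ofReal_tsum_of_nonneg (fun j => by positivity) h1]
    exact ENNReal.ofReal_ne_top
  have hbc := ae_eventually_notMem hsum
  have h0 : ∀ᵐ t : ℝ, t ≠ 0 := by simp [ae_iff]
  have h1 : ∀ᵐ t : ℝ, t ≠ 1 := by simp [ae_iff]
  filter_upwards [hbc, h0, h1] with t ht ht0 ht1 htI
  have htI' : t ∈ Set.Ioo (0 : ℝ) 1 := ⟨lt_of_le_of_ne htI.1 ht0.symm, lt_of_le_of_ne htI.2 ht1⟩
  filter_upwards [ht, h.regular.eventually_sum_eq_periodizedWavelet htI'] with j hj hj'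
  rw [hj']
  by_contra hlt
  exact hj ⟨htI, not_le.1 hlt⟩

/-- For almost every `a`, the factors of the coefficients of the traces of the probe which depend
on `a` decay at most polynomially in the scale. -/
theorem WaveletHypothesis.ae_eventually_le_abs_prod_sum (h : WaveletHypothesis N φ ψ) (d' : ℕ) :
    ∀ᵐ a ∂(volume.restrict (Set.Icc (0 : Fin d' → ℝ) 1)), ∀ᶠ j : ℕ in atTop,
      ((((j : ℝ) + 1) ^ 2)⁻¹) ^ d' ≤
        |∏ i, ∑ n : Fin (2 ^ j), ψ ((2 : ℝ) ^ j * a i - ((n : ℕ) : ℝ))| := by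
  rw [ae_restrict_iff' measurableSet_Icc]
  have hall : ∀ᵐ a : Fin d' → ℝ, ∀ i, a i ∈ Set.Icc (0 : ℝ) 1 → ∀ᶠ j : ℕ in atTop,
      (((j : ℝ) + 1) ^ 2)⁻¹ ≤ |∑ n : Fin (2 ^ j), ψ ((2 : ℝ) ^ j * a i - ((n : ℕ) : ℝ))| :=
    ae_all_iff.2 fun i =>
      (Measure.quasiMeasurePreserving_eval (fun _ : Fin d' => (volume : Measure ℝ)) i).ae
        h.ae_eventually_le_abs_sum
  filter_upwards [hall] with a ha haI
  filter_upwards [eventually_all.2 fun i => ha i ⟨haI.1 i, haI.2 i⟩] with j hj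
  rw [Finset.abs_prod]
  calc ((((j : ℝ) + 1) ^ 2)⁻¹) ^ d' = ∏ _i : Fin d', (((j : ℝ) + 1) ^ 2)⁻¹ := by simp
    _ ≤ _ := Finset.prod_le_prod (fun _ _ => by positivity) fun i _ => hj i

end Periodized

/-! ### Probability estimates -/

/-- An affine map of slope `v` pulls `[-r, r]` back to an interval of length `2r/|v|`. The bound is
uniform in `u`, that is, in the function being perturbed. -/
theorem volume_unitInterval_abs_add_mul_le (u : ℝ) {v : ℝ} (hv : v ≠ 0) (r : ℝ) :
    volume {t : unitInterval | |u + t * v| ≤ r} ≤ ENNReal.ofReal (2 * r / |v|) := by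
  rw [Measure.Subtype.volume_def, comap_subtype_coe_apply measurableSet_Icc]
  have hsub : ((↑) : unitInterval → ℝ) '' {t : unitInterval | |u + t * v| ≤ r} ⊆
      Metric.closedBall (-u / v) (r / |v|) := by
    rintro _ ⟨t, ht, rfl⟩
    rw [Metric.mem_closedBall, Real.dist_eq, le_div_iff₀ (abs_pos.2 hv), ← abs_mul]
    have : ((t : ℝ) - -u / v) * v = u + t * v := by
      field_simp
      ring
    rw [this]
    exact ht
  refine (measure_mono hsub).trans (le_of_eq ?_)
  rw [Real.volume_closedBall, mul_div_assoc]

/-- The event is a cylinder with one condition per scale, so independence multiplies the `M`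
probabilities. -/
theorem infinitePi_forall_abs_add_mul_le {u v : ℕ → ℝ} {r ε : ℝ} {j M : ℕ}
    (h : ∀ i ∈ Finset.Ico j (j + M), v i ≠ 0 ∧ 2 * r / |v i| ≤ ε) :
    Measure.infinitePi (fun _ : ℕ => (volume : Measure unitInterval))
      {z | ∀ i ∈ Finset.Ico j (j + M), |u i + z i * v i| ≤ r} ≤ ENNReal.ofReal ε ^ M := by
  have hset : {z : ℕ → unitInterval | ∀ i ∈ Finset.Ico j (j + M), |u i + z i * v i| ≤ r} =
      Set.pi (Finset.Ico j (j + M) : Set ℕ) fun i =>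
        {t : unitInterval | |u i + t * v i| ≤ r} := by
    ext z
    simp only [Set.mem_pi, Finset.mem_coe]
    rfl
  rw [hset, Measure.infinitePi_pi _ fun i _ => measurableSet_le (by fun_prop) measurable_const]
  calc ∏ i ∈ Finset.Ico j (j + M), volume {t : unitInterval | |u i + t * v i| ≤ r}
      ≤ ∏ _i ∈ Finset.Ico j (j + M), ENNReal.ofReal ε :=
        Finset.prod_le_prod' fun i hi => (volume_unitInterval_abs_add_mul_le _ (h i hi).1 r).trans
          (ENNReal.ofReal_le_ofReal (h i hi).2)
    _ = ENNReal.ofReal ε ^ M := by simp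

theorem eventually_rpow_mul_two_rpow_le (C κ B : ℝ) {A c : ℝ} (hA : 0 < A) (hc : 0 < c) :
    ∀ᶠ J : ℕ in atTop, C * (A * J + B) ^ κ * (2 : ℝ) ^ (-(c * J)) ≤ 1 := by
  -- With `x = A J + B`, this `b` turns `2^{-cJ}` into a constant times `exp(-b x)`, and the
  -- exponential beats `x^κ`.
  set b : ℝ := c * Real.log 2 / A with hb
  have hlog : 0 < Real.log 2 := Real.log_pos one_lt_two
  have hb0 : 0 < b := by positivity
  have hx : Tendsto (fun J : ℕ => A * (J : ℝ) + B) atTop atTop :=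
    tendsto_atTop_add_const_right _ _ (tendsto_natCast_atTop_atTop.const_mul_atTop hA)
  have h1 := ((tendsto_rpow_mul_exp_neg_mul_atTop_nhds_zero κ b hb0).comp hx).const_mul
    (C * Real.exp (b * B))
  rw [mul_zero] at h1
  filter_upwards [h1.eventually (ge_mem_nhds zero_lt_one)] with J hJ
  refine le_trans (le_of_eq ?_) hJ
  have h2 : (2 : ℝ) ^ (-(c * J)) = Real.exp (b * B) * Real.exp (-b * (A * J + B)) := by
    rw [← Real.exp_add, Real.rpow_def_of_pos two_pos]
    congr 1
    rw [hb]
    field_simp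
    ring
  rw [h2, Function.comp_apply]
  ring

/-- The factors decreasing in `i` are evaluated at the upper bound `Y`, which gives one lower bound
for a whole window of scales. -/
theorem le_abs_probeAmplitude_mul {d d' : ℕ} {s p : ℝ} (hp : 0 < p) (q : ℝ≥0∞)
    (hs : 0 ≤ s - d / p) {i J : ℕ} (hJ : J ≤ i) {Y g : ℝ} (hY : (i : ℝ) + 1 ≤ Y)
    (hg : ((((i : ℝ) + 1) ^ 2)⁻¹) ^ d' ≤ |g|) (K : Fin d → ℕ) :
    Y ^ (-(probeExponent p q + 2 * d')) * (2 : ℝ) ^ (-((s - d / p) * Y)) *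
      (2 : ℝ) ^ (-(d / p * J)) ≤ |probeAmplitude s p q i (fun l => K l * 2 ^ (i - J)) * g| := by
  have hi : (0 : ℝ) < (i : ℝ) + 1 := by positivity
  have hκ : 0 ≤ probeExponent p q := by
    unfold probeExponent
    positivity
  rw [abs_mul, abs_of_nonneg (probeAmplitude_nonneg _ _ _ _ _), probeAmplitude]
  have h1 : Y ^ (-(probeExponent p q + 2 * d')) ≤
      ((i : ℝ) + 1) ^ (-probeExponent p q) * ((((i : ℝ) + 1) ^ 2)⁻¹) ^ d' := by
    refine (Real.rpow_le_rpow_of_nonpos hi hY (by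
      have : (0 : ℝ) ≤ d' := Nat.cast_nonneg _
      linarith)).trans (le_of_eq ?_)
    rw [neg_add, Real.rpow_add hi, inv_pow, ← pow_mul, Real.rpow_neg hi.le (2 * (d' : ℝ)),
      ← Real.rpow_natCast _ (2 * d')]
    push_cast
    rfl
  have h2 : (2 : ℝ) ^ (-((s - d / p) * Y)) ≤ (2 : ℝ) ^ (-((s - d / p) * i)) := by
    refine Real.rpow_le_rpow_of_exponent_le one_le_two ?_
    have : (s - d / p) * i ≤ (s - d / p) * Y := mul_le_mul_of_nonneg_left (by linarith) hs
    linarith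
  have h3 : (2 : ℝ) ^ (-(d / p * J)) ≤
      dyadicWeight i (fun l => K l * 2 ^ (i - J)) ^ (1 / p) := by
    refine le_trans (le_of_eq ?_) (Real.rpow_le_rpow (by positivity) (le_dyadicWeight hJ K)
      (by positivity))
    rw [← Real.rpow_natCast, ← Real.rpow_neg two_pos.le, ← Real.rpow_mul two_pos.le]
    push_cast
    congr 1
    field_simp
  calc _ ≤ ((i : ℝ) + 1) ^ (-probeExponent p q) * ((((i : ℝ) + 1) ^ 2)⁻¹) ^ d' *
        (2 : ℝ) ^ (-((s - d / p) * i)) *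
          dyadicWeight i (fun l => K l * 2 ^ (i - J)) ^ (1 / p) := by
        gcongr
    _ ≤ ((i : ℝ) + 1) ^ (-probeExponent p q) * |g| *
        (2 : ℝ) ^ (-((s - d / p) * i)) *
          dyadicWeight i (fun l => K l * 2 ^ (i - J)) ^ (1 / p) := by
        have := dyadicWeight_nonneg i (fun l => K l * 2 ^ (i - J))
        gcongr
    _ = _ := by ring

/-! ### Borel–Cantelli for a fixed trace, then Fubini -/

section Prevalence

variable {N d d' : ℕ} {φ ψ : ℝ → ℝ} {s p : ℝ} {q : ℝ≥0∞}

/-- The probability that a perturbed trace has small coefficients at some dyadic point of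
generation `J`. -/
theorem infinitePi_hasSmallCoeffs_le (h : IsRegularWaveletPair N φ ψ) (hd : 0 < d) (hp : 0 < p)
    (hq : 0 < q) (hs : 0 < s - ((d + d' : ℕ) : ℝ) / p) {α H : ℝ} (hα : 1 ≤ α)
    (f : BesovSpace (d + d') φ ψ s hp hq) (a : Fin d' → ℝ) (n : ℕ) {J M : ℕ} (hJ : 0 < J) {ε : ℝ}
    (hε : ∀ i ∈ Finset.Ico ⌈α * J⌉₊ (⌈α * J⌉₊ + M), ∀ K : Fin d → Fin (2 ^ J), ∀ v : ℝ,
      v = probeAmplitude s p q i (fun l => (K l : ℕ) * 2 ^ (i - J)) *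
        ∏ l, ∑ n : Fin (2 ^ i), ψ ((2 : ℝ) ^ i * a l - ((n : ℕ) : ℝ)) →
      v ≠ 0 ∧ 2 * (n * (2 : ℝ) ^ (-((H + 1 / (n + 1)) * (α * J)))) / |v| ≤ ε) :
    Measure.infinitePi (fun _ : ℕ => (volume : Measure unitInterval))
      {z | HasSmallCoeffs (d := d) ψ α H n J (probe h hp hq hs z + f).toFun a} ≤
        ((2 : ℝ≥0∞) ^ J) ^ d * ENNReal.ofReal ε ^ M := by
  set j := ⌈α * J⌉₊
  have hJj : J ≤ j := le_ceil_mul hα J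
  let v : (Fin d → Fin (2 ^ J)) → ℕ → ℝ := fun K i =>
    probeAmplitude s p q i (fun l => (K l : ℕ) * 2 ^ (i - J)) *
      ∏ l, ∑ n : Fin (2 ^ i), ψ ((2 : ℝ) ^ i * a l - ((n : ℕ) : ℝ))
  let u : (Fin d → Fin (2 ^ J)) → ℕ → ℝ := fun K i =>
    traceCoeff ψ i (fun l => (K l : ℕ) * 2 ^ (i - J)) f.toFun a
  have hcoeff : ∀ (K : Fin d → Fin (2 ^ J)) (i : ℕ), j ≤ i → ∀ z : ℕ → unitInterval,
      traceCoeff ψ i (fun l => (K l : ℕ) * 2 ^ (i - J)) (probe h hp hq hs z + f).toFun a =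
        u K i + z i * v K i := by
    intro K i hi z
    have hlt : ∀ l, (K l : ℕ) * 2 ^ (i - J) < 2 ^ i := fun l => by
      calc (K l : ℕ) * 2 ^ (i - J) < 2 ^ J * 2 ^ (i - J) :=
            Nat.mul_lt_mul_of_pos_right (K l).2 (by positivity)
        _ = 2 ^ i := by rw [← pow_add, Nat.add_sub_cancel' (hJj.trans hi)]
    rw [BesovSpace.traceCoeff_add h hs]
    have := traceCoeff_probe h hd hp hq hs z a ⟨i, hJ.trans_le (hJj.trans hi)⟩
      fun l => ⟨(K l : ℕ) * 2 ^ (i - J), hlt l⟩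
    simp only [PNat.mk_coe] at this
    rw [this, add_comm, mul_assoc]
    rfl
  -- Only the first `M` scales above `αJ` are retained; the union over `K` costs the factor
  -- `2^{Jd}`.
  have hsub : {z : ℕ → unitInterval |
      HasSmallCoeffs (d := d) ψ α H n J (probe h hp hq hs z + f).toFun a} ⊆
      ⋃ K ∈ (Finset.univ : Finset (Fin d → Fin (2 ^ J))),
        {z | ∀ i ∈ Finset.Ico j (j + M), |u K i + z i * v K i| ≤
          n * (2 : ℝ) ^ (-((H + 1 / (n + 1)) * (α * J)))} := by
    rintro z ⟨K, hK⟩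
    refine Set.mem_biUnion (Finset.mem_coe.2 (Finset.mem_univ K)) fun i hi => ?_
    have hi' := (Finset.mem_Ico.1 hi).1
    have := hK (i - j)
    rwa [show ⌈α * J⌉₊ + (i - j) = i from Nat.add_sub_cancel' hi', hcoeff K i hi'] at this
  refine (measure_mono hsub).trans ((measure_biUnion_finset_le _ _).trans ?_)
  refine (Finset.sum_le_card_nsmul _ _ (ENNReal.ofReal ε ^ M) fun K _ =>
    infinitePi_forall_abs_add_mul_le fun i hi => hε i hi K _ rfl).trans (le_of_eq ?_)
  simp [nsmul_eq_mul]

theorem ae_not_frequently_hasSmallCoeffs (h : IsRegularWaveletPair N φ ψ) (hd : 0 < d) (hp : 0 < p)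
    (hq : 0 < q) (hs : 0 < s - ((d + d' : ℕ) : ℝ) / p) {α : ℝ} (hα : 1 ≤ α)
    (f : BesovSpace (d + d') φ ψ s hp hq) {a : Fin d' → ℝ}
    (ha : ∀ᶠ j : ℕ in atTop, ((((j : ℝ) + 1) ^ 2)⁻¹) ^ d' ≤
      |∏ i, ∑ n : Fin (2 ^ j), ψ ((2 : ℝ) ^ j * a i - ((n : ℕ) : ℝ))|) (n : ℕ) :
    ∀ᵐ z ∂(Measure.infinitePi (fun _ : ℕ => (volume : Measure unitInterval))),
      ¬ ∃ᶠ J : ℕ in atTop, HasSmallCoeffs (d := d) ψ α (exponentH d s p α) n J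
        (probe h hp hq hs z + f).toFun a := by
  have hsd : 0 ≤ s - d / p := by
    have : (d : ℝ) / p ≤ ((d + d' : ℕ) : ℝ) / p := by
      gcongr
      exact Nat.le_add_right _ _
    linarith
  have hα0 : 0 < α := by linarith
  obtain ⟨j₀, hj₀⟩ := eventually_atTop.1 ha
  -- With `ε = 2^{-J/(2(n+1))}`, this gives `2^{dJ} ε^M = 2^{-J}`, which is summable.
  set M := 2 * (n + 1) * (d + 1) with hM
  set κ := probeExponent p q + 2 * d' with hκ
  have hn0 : (0 : ℝ) < n + 1 := by positivity
  -- The gain `2^{-αJ/(n+1)}` over `2^{-H(α)αJ}` is split in two: one half absorbs the powers of the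
  -- scale and the constants, the other becomes `ε`.
  obtain ⟨J₁, hJ₁⟩ := eventually_atTop.1 (eventually_rpow_mul_two_rpow_le
    (2 * n * (2 : ℝ) ^ ((s - d / p) * (M + 2))) κ (M + 2) hα0
    (by positivity : (0 : ℝ) < 1 / (2 * (n + 1))))
  set J₀ := max (max j₀ J₁) 1
  have hbound : ∀ J : ℕ, J₀ ≤ J → Measure.infinitePi (fun _ : ℕ => (volume : Measure unitInterval))
      {z | HasSmallCoeffs (d := d) ψ α (exponentH d s p α) n J
        (probe h hp hq hs z + f).toFun a} ≤ ENNReal.ofReal ((1 / 2) ^ J) := by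
    intro J hJ
    have hj₀J : j₀ ≤ J := (le_max_left _ _).trans ((le_max_left _ _).trans hJ)
    have hJ₁J : J₁ ≤ J := (le_max_right _ _).trans ((le_max_left _ _).trans hJ)
    have h1J : 1 ≤ J := (le_max_right _ _).trans hJ
    set ε : ℝ := (2 : ℝ) ^ (-(1 / (2 * ((n : ℝ) + 1)) * J)) with hεdef
    refine (infinitePi_hasSmallCoeffs_le h hd hp hq hs hα f a n h1J (M := M) (ε := ε) ?_).trans ?_
    · intro i hi K v hv
      rw [Finset.mem_Ico] at hi
      have hJi : J ≤ i := (le_ceil_mul hα J).trans hi.1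
      set Y : ℝ := α * J + (M + 2) with hY
      have hY0 : 0 < Y := by positivity
      have hiY : (i : ℝ) + 1 ≤ Y := by
        have h1 : (i : ℝ) + 1 ≤ ⌈α * J⌉₊ + M := by exact_mod_cast hi.2
        have h2 := Nat.ceil_lt_add_one (by positivity : 0 ≤ α * J)
        linarith
      have hlow := le_abs_probeAmplitude_mul (d' := d') hp q hsd hJi hiY
        (hj₀ i (hj₀J.trans hJi)) (fun l => (K l : ℕ))
      rw [← hv] at hlow
      have hlow0 : 0 < Y ^ (-(probeExponent p q + 2 * d')) * (2 : ℝ) ^ (-((s - d / p) * Y)) *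
        (2 : ℝ) ^ (-(d / p * J)) := by positivity
      refine ⟨abs_pos.1 (hlow0.trans_le hlow), ?_⟩
      rw [div_le_iff₀ (hlow0.trans_le hlow)]
      refine le_trans ?_ (mul_le_mul_of_nonneg_left hlow (by positivity))
      have hmain := hJ₁ J hJ₁J
      -- This is where the formula for `H(α)` enters: `H(α) α = (s - d/p) α + d/p`, the exponent of
      -- the probe at scale `αJ` around a dyadic point of generation `J`.
      have hexp : 2 * (n * (2 : ℝ) ^ (-((exponentH d s p α + 1 / (n + 1)) * (α * J)))) =
          2 * n * (2 : ℝ) ^ ((s - d / p) * (M + 2)) * (2 : ℝ) ^ (-(1 / (n + 1) * (α * J))) *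
            (2 : ℝ) ^ (-((s - d / p) * Y)) * (2 : ℝ) ^ (-(d / p * J)) := by
        rw [mul_assoc (2 * (n : ℝ)), mul_assoc (2 * (n : ℝ)), mul_assoc (2 * (n : ℝ)),
          ← Real.rpow_add two_pos, ← Real.rpow_add two_pos, ← Real.rpow_add two_pos, ← mul_assoc]
        congr 2
        rw [exponentH, hY]
        field_simp
        ring
      have hYκ : Y ^ κ * Y ^ (-κ) = 1 := by
        rw [← Real.rpow_add hY0, add_neg_cancel, Real.rpow_zero]
      have hdecay : (2 : ℝ) ^ (-(1 / ((n : ℝ) + 1) * (α * J))) ≤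
          (2 : ℝ) ^ (-(1 / (2 * ((n : ℝ) + 1)) * J)) * ε := by
        rw [hεdef, ← Real.rpow_add two_pos]
        refine Real.rpow_le_rpow_of_exponent_le one_le_two ?_
        have h1 : (J : ℝ) ≤ α * J := le_mul_of_one_le_left (Nat.cast_nonneg J) hα
        have h2 : 1 / ((n : ℝ) + 1) * J ≤ 1 / ((n : ℝ) + 1) * (α * J) :=
          mul_le_mul_of_nonneg_left h1 (by positivity)
        have h3 : 1 / (2 * ((n : ℝ) + 1)) * J + 1 / (2 * ((n : ℝ) + 1)) * J =
            1 / ((n : ℝ) + 1) * J := by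
          field_simp
          ring
        linarith
      have hε0 : 0 < ε := by positivity
      rw [hexp]
      have hX : 2 * n * (2 : ℝ) ^ ((s - d / p) * (M + 2)) *
          (2 : ℝ) ^ (-(1 / ((n : ℝ) + 1) * (α * J))) ≤ ε * Y ^ (-κ) := by
        calc 2 * n * (2 : ℝ) ^ ((s - d / p) * (M + 2)) *
              (2 : ℝ) ^ (-(1 / ((n : ℝ) + 1) * (α * J)))
            ≤ 2 * n * (2 : ℝ) ^ ((s - d / p) * (M + 2)) *
              ((2 : ℝ) ^ (-(1 / (2 * ((n : ℝ) + 1)) * J)) * ε) :=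
              mul_le_mul_of_nonneg_left hdecay (by positivity)
          _ = (2 * n * (2 : ℝ) ^ ((s - d / p) * (M + 2)) * Y ^ κ *
              (2 : ℝ) ^ (-(1 / (2 * ((n : ℝ) + 1)) * J))) * (ε * Y ^ (-κ)) := by
              linear_combination -(2 * n * (2 : ℝ) ^ ((s - d / p) * (M + 2)) *
                (2 : ℝ) ^ (-(1 / (2 * ((n : ℝ) + 1)) * J)) * ε) * hYκ
          _ ≤ 1 * (ε * Y ^ (-κ)) := mul_le_mul_of_nonneg_right hmain (by positivity)
          _ = _ := one_mul _
      calc _ ≤ ε * Y ^ (-κ) * (2 : ℝ) ^ (-((s - d / p) * Y)) * (2 : ℝ) ^ (-(d / p * J)) := by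
            gcongr
        _ = _ := by ring
    · rw [← ENNReal.ofReal_pow (by positivity), ← ENNReal.ofReal_ofNat 2,
        ← ENNReal.ofReal_pow two_pos.le, ← ENNReal.ofReal_pow (by positivity),
        ← ENNReal.ofReal_mul (by positivity)]
      refine ENNReal.ofReal_le_ofReal (le_of_eq ?_)
      have h1 : ε ^ M = (2 : ℝ) ^ (-((d + 1) * (J : ℝ))) := by
        rw [hεdef, ← Real.rpow_natCast, ← Real.rpow_mul two_pos.le, hM]
        push_cast
        congr 1
        field_simp
      rw [h1, ← pow_mul, ← Real.rpow_natCast 2, ← Real.rpow_add two_pos, one_div, inv_pow,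
        ← Real.rpow_natCast 2 J, ← Real.rpow_neg two_pos.le]
      push_cast
      ring_nf
  have hsum : ∑' J : ℕ, Measure.infinitePi (fun _ : ℕ => (volume : Measure unitInterval))
      {z | J₀ ≤ J ∧ HasSmallCoeffs (d := d) ψ α (exponentH d s p α) n J
        (probe h hp hq hs z + f).toFun a} ≠ ⊤ := by
    refine ne_top_of_le_ne_top (b := ∑' J : ℕ, ENNReal.ofReal ((1 / 2) ^ J)) ?_
      (ENNReal.tsum_le_tsum fun J => ?_)
    · rw [← ENNReal.ofReal_tsum_of_nonneg (fun J => by positivity) summable_geometric_two]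
      exact ENNReal.ofReal_ne_top
    · by_cases hJ : J₀ ≤ J
      · simpa [hJ] using hbound J hJ
      · simp [hJ]
  filter_upwards [ae_eventually_notMem hsum] with z hz hfreq
  obtain ⟨J, hJ, hJ', hJ''⟩ :=
    (hfreq.and_eventually (hz.and (eventually_ge_atTop J₀))).exists
  exact hJ' ⟨hJ'', hJ⟩

end Prevalence

theorem mainTheorem3 (d d' : ℕ) (hd : 0 < d) (hd' : 0 < d')
    (s p : ℝ) (hp : 0 < p) (q : ℝ≥0∞) (hq : 0 < q) (hs : 0 < s - ((d + d' : ℕ) : ℝ) / p)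
    (N : ℕ) (hN : ⌊s + 1⌋₊ ≤ N) (φ ψ : ℝ → ℝ) (hψ : WaveletHypothesis N φ ψ)
    (α : ℝ) (hα : 1 ≤ α) :
    IsPrevalent {f : BesovSpace (d + d') φ ψ s hp hq |
      ∀ᵐ a ∂(volume.restrict (Set.Icc (0 : Fin d' → ℝ) 1)),
        ∀ x ∈ dyadicApprox d α,
          holderExponent (traceAt f.toFun a) x ≤ (exponentH d s p α : EReal)} := by
  have h := hψ.regular
  set H := exponentH d s p α with hHdef
  set ν : Measure (Fin d' → ℝ) := volume.restrict (Set.Icc (0 : Fin d' → ℝ) 1) with hν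
  let P := Measure.infinitePi (fun _ : ℕ => (volume : Measure unitInterval))
  have hα0 : 0 < α := by linarith
  have hsd : 0 < s - d / p := by
    have : (d : ℝ) / p ≤ ((d + d' : ℕ) : ℝ) / p := by
      gcongr
      exact Nat.le_add_right _ _
    linarith
  have hH0 : 0 ≤ H := by
    have : 0 ≤ (d : ℝ) / (α * p) := by positivity
    rw [hHdef, exponentH]
    linarith
  -- Indeed `H ≤ s < ⌊s + 1⌋ ≤ N`, where `α ≥ 1` gives the first inequality.
  have hHN : H < N := by
    have h1 : (d : ℝ) / (α * p) ≤ d / p := by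
      gcongr
      exact le_mul_of_one_le_left hp.le hα
    have h2 := Nat.lt_floor_add_one (s + 1)
    have h3 : ((⌊s + 1⌋₊ : ℕ) : ℝ) ≤ N := by exact_mod_cast hN
    rw [hHdef, exponentH]
    linarith
  let bad : Set (BesovSpace (d + d') φ ψ s hp hq × (Fin d' → ℝ)) :=
    {y | ∃ n : ℕ, ∃ᶠ J : ℕ in atTop, HasSmallCoeffs (d := d) ψ α H n J y.1.toFun y.2}
  have hbad : MeasurableSet bad :=
    BesovSpace.measurableSet_exists_frequently_hasSmallCoeffs h hs α H
  have hB : MeasurableSet {f : BesovSpace (d + d') φ ψ s hp hq | ν (Prod.mk f ⁻¹' bad) ≠ 0} :=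
    (measurable_measure_prodMk_left hbad) (measurableSet_singleton 0).compl
  have hcont := continuous_probe h hp hq hs
  -- The exceptional set is enlarged to a Borel set defined through coefficients only; being Borel,
  -- it is universally measurable.
  refine ⟨{f | ν (Prod.mk f ⁻¹' bad) ≠ 0}, ?_, fun _ _ => hB.nullMeasurableSet,
    P.map (probe h hp hq hs), ⟨Set.range (probe h hp hq hs), isCompact_range hcont, ?_, ?_⟩, ?_⟩
  · intro f hf hnull
    refine hf ?_
    filter_upwards [measure_eq_zero_iff_ae_notMem.1 hnull] with a ha x hx
    by_contra hlt
    exact ha (f.exists_frequently_hasSmallCoeffs h hd hs hα hH0 hHN a hx (not_le.1 hlt))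
  -- The inequality suffices here, so measurability of the range is not required.
  · refine lt_of_lt_of_le ?_ (Measure.le_map_apply hcont.measurable.aemeasurable _)
    rw [Set.preimage_range, measure_univ]
    exact zero_lt_one
  · refine (measure_mono (Set.subset_univ _)).trans_lt ?_
    rw [Measure.map_apply hcont.measurable MeasurableSet.univ, Set.preimage_univ, measure_univ]
    exact ENNReal.one_lt_top
  · intro f
    rw [Set.image_add_right]
    have htrans : Measurable fun g : BesovSpace (d + d') φ ψ s hp hq => g + -f :=
      (BesovSpace.continuous_add_right (-f)).measurable
    rw [Measure.map_apply hcont.measurable (htrans hB), measure_eq_zero_iff_ae_notMem]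
    have hmeas : MeasurableSet {y : (ℕ → unitInterval) × (Fin d' → ℝ) |
        (probe h hp hq hs y.1 + -f, y.2) ∉ bad} :=
      ((htrans.comp (hcont.measurable.comp measurable_fst)).prodMk measurable_snd) hbad.compl
    -- Fubini: the probabilistic estimate is available for almost every fixed `a`, whereas shyness
    -- asks for almost every `z` first. The translate is treated by perturbing `-f`.
    have hswap : ∀ᵐ z ∂P, ∀ᵐ a ∂ν, (probe h hp hq hs z + -f, a) ∉ bad := by
      refine (Measure.ae_ae_comm (p := fun z a => (probe h hp hq hs z + -f, a) ∉ bad) hmeas).2 ?_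
      filter_upwards [hψ.ae_eventually_le_abs_prod_sum d'] with a ha
      filter_upwards [ae_all_iff.2 fun n =>
        ae_not_frequently_hasSmallCoeffs h hd hp hq hs hα (-f) ha n] with z hz
      rintro ⟨n, hn⟩
      exact hz n hn
    filter_upwards [hswap] with z hz hmem
    exact hmem (measure_eq_zero_iff_ae_notMem.2 hz)
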